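/- Let $H$ be a complex Hilbert space, $\Omega\subseteq\mathbb C$ open and connected, $A:\Omega\to\mathcal B(H)$ analytic, and let $z_0\in\Omega$ be a zero of finite type of $A(\cdot)$; that is, $A(z_0)$ is a Fredholm operator, $\ker A(z_0)\neq\{0\}$, and $A(z)$ is boundedly invertible for all $z\neq z_0$ in some disk centered at $z_0$. Assume that $0$ is an isolated point of the spectrum of $A(z_0)$ (so that the Riesz projections below are defined), and let $\varepsilon>0$ be such that $\zeta\in\rho(A(z_0))$ for all $0<|\zeta|\le\varepsilon$. (Gohberg–Sigal multiplicity.) There are a neighborhood $N$ of $z_0$, analytic functions $E_1,E_2$ on $N$ whose values are boundedly invertible operators, an integer $r\ge 0$, mutually disjoint (not necessarily orthogonal) projections $\widetilde P_0,\dots,\widetilde P_r$ in $H$ with $I-\widetilde P_0$ of finite rank and $\dim\operatorname{ran}\widetilde P_j=1$ for $1\le j\le r$, and integers $1\le n_1\le\dots\le n_r$, such that $$A(z)=E_1(z)\Big[\widetilde P_0+\sum_{j=1}^r (z-z_0)^{n_j}\widetilde P_j\Big]E_2(z),\qquad z\in N,$$ and the number $m_a(z_0;A(\cdot))=\sum_{j=1}^r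 n_j$ is the same for all such factorizations. (Howland multiplicity.) For $z$ near $z_0$ put $P(z)=\frac{-1}{2\pi i}\oint_{|\zeta|=\varepsilon}(A(z)-\zeta I)^{-1}\,d\zeta$, $Q(z)=I-P(z)$ and $T(z)=P(z_0)P(z)+Q(z_0)Q(z)$. Then, near $z_0$, the circle $|\zeta|=\varepsilon$ lies in $\rho(A(z))$, $P(\cdot)$ is analytic, $P(z_0)$ is a projection of finite rank, $T(z)$ is boundedly invertible, and $$T(z)A(z)T(z)^{-1}=\begin{pmatrix}F(z)&0\\0&G(z)\end{pmatrix}\quad\text{in } H=\operatorname{ran}P(z_0)\dotplus\operatorname{ran}Q(z_0),$$ with $F$, $G$ analytic and $G(z)$ boundedly invertible. Let $\nu(z_0;A(\cdot))$ be the order of vanishing at $z_0$ of the analytic function $z\mapsto\det_{\operatorname{ran}P(z_0)}F(z)$ ($\infty$ if it vanishes identically near $z_0$). Then $$m_a(z_0;A(\cdot))=\nu(z_0;A(\cdot)).$$ In particular $\nu(z_0;A(\cdot))$ is finite and independent of $\varepsilon$. -/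

import Mathlib

noncomputable section

namespace AnalyticFredholm

open Topology

variable {H : Type*} [NormedAddCommGroup H] [InnerProductSpace ℂ H] [CompleteSpace H]

/-- `z₀` is a zero of finite type of the (analytic) function `A`: `A z₀` is a Fredholm operator
with nontrivial kernel, and `A z` is boundedly invertible in a punctured disk around `z₀`. -/
structure IsZeroOfFiniteType (A : ℂ → H →L[ℂ] H) (z₀ : ℂ) : Prop where
  isFredholm : (A z₀).IsFredholm
  ker_ne_bot : (A z₀).ker ≠ ⊥
  isUnit_punctured : ∃ ε₀ : ℝ, 0 < ε₀ ∧ ∀ z ∈ Metric.ball z₀ ε₀, z ≠ z₀ → IsUnit (A z)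

/-! ### The Gohberg-Sigal algebraic multiplicity -/

/-- The exponents `n 0 ≤ ... ≤ n (r - 1)`, all positive, occur in a local factorization
`A z = E₁ z * (P₀ + ∑ j, (z - z₀) ^ n j • P j) * E₂ z` in a neighbourhood `N` of `z₀`, where
`E₁`, `E₂` are analytic with boundedly invertible values, `P₀` and the `P j` are mutually disjoint
(not necessarily orthogonal) projections, `1 - P₀` has finite rank and each `P j` has rank one. -/
def HasLocalSmithForm (A : ℂ → H →L[ℂ] H) (z₀ : ℂ) (r : ℕ) (n : Fin r → ℕ) : Prop :=
  (∀ j, 1 ≤ n j) ∧ Monotone n ∧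
  ∃ (N : Set ℂ) (E₁ E₂ : ℂ → H →L[ℂ] H) (P₀ : H →L[ℂ] H) (P : Fin r → H →L[ℂ] H),
    IsOpen N ∧ z₀ ∈ N ∧
    AnalyticOnNhd ℂ E₁ N ∧ AnalyticOnNhd ℂ E₂ N ∧
    (∀ z ∈ N, IsUnit (E₁ z)) ∧ (∀ z ∈ N, IsUnit (E₂ z)) ∧
    IsIdempotentElem P₀ ∧ (∀ j, IsIdempotentElem (P j)) ∧
    (∀ j, P₀ * P j = 0 ∧ P j * P₀ = 0) ∧ (∀ i j, i ≠ j → P i * P j = 0) ∧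
    FiniteDimensional ℂ (1 - P₀).range ∧ (∀ j, Module.finrank ℂ (P j).range = 1) ∧
    ∀ z ∈ N, A z = E₁ z * (P₀ + ∑ j, (z - z₀) ^ n j • P j) * E₂ z

open Classical in
/-- The algebraic multiplicity `m_a(z₀; A(·)) = n₁ + ... + n_r`, the sum of the exponents in a
local factorization as in `HasLocalSmithForm` (and `0` by convention if there is none). -/
def algebraicMultiplicity (A : ℂ → H →L[ℂ] H) (z₀ : ℂ) : ℕ :=
  if h : ∃ m : ℕ, ∃ (r : ℕ) (n : Fin r → ℕ), HasLocalSmithForm A z₀ r n ∧ m = ∑ j, n j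
  then h.choose else 0

/-! ### Howland's multiplicity -/

/-- The Riesz projection `-(2πi)⁻¹ ∮ (B - ζ)⁻¹ dζ` of `B` over the circle `|ζ| = ε`. -/
def rieszProjection (B : H →L[ℂ] H) (ε : ℝ) : H →L[ℂ] H :=
  (-1 / (2 * (Real.pi : ℂ) * Complex.I)) •
    circleIntegral (fun ζ : ℂ => Ring.inverse (B - ζ • (1 : H →L[ℂ] H))) 0 ε

/-- The transformation `T z = P(z₀) P(z) + Q(z₀) Q(z)`, where `P(z)` is the Riesz projection of
`A z` over the circle `|ζ| = ε` and `Q(z) = 1 - P(z)`. -/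
def transformation (A : ℂ → H →L[ℂ] H) (z₀ : ℂ) (ε : ℝ) (z : ℂ) : H →L[ℂ] H :=
  rieszProjection (A z₀) ε * rieszProjection (A z) ε +
    (1 - rieszProjection (A z₀) ε) * (1 - rieszProjection (A z) ε)

/-- The operator `T(z) A(z) T(z)⁻¹`. -/
def transformed (A : ℂ → H →L[ℂ] H) (z₀ : ℂ) (ε : ℝ) (z : ℂ) : H →L[ℂ] H :=
  transformation A z₀ ε z * A z * Ring.inverse (transformation A z₀ ε z)

/-- The diagonal block `P M|_{ran P}` of the operator `M`, as an operator on `ran P`. -/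
def compress (P M : H →L[ℂ] H) : P.range →L[ℂ] P.range :=
  (P ∘L M ∘L P.range.subtypeL).codRestrict P.range (fun x => ⟨M x, rfl⟩)

/-- The block `F(z)` of `T(z) A(z) T(z)⁻¹`, acting in `ran P(z₀)`. -/
def blockF (A : ℂ → H →L[ℂ] H) (z₀ : ℂ) (ε : ℝ) (z : ℂ) :
    (rieszProjection (A z₀) ε).range →L[ℂ] (rieszProjection (A z₀) ε).range :=
  compress (rieszProjection (A z₀) ε) (transformed A z₀ ε z)

/-- The block `G(z)` of `T(z) A(z) T(z)⁻¹`, acting in `ran Q(z₀)`. -/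
def blockG (A : ℂ → H →L[ℂ] H) (z₀ : ℂ) (ε : ℝ) (z : ℂ) :
    (1 - rieszProjection (A z₀) ε).range →L[ℂ] (1 - rieszProjection (A z₀) ε).range :=
  compress (1 - rieszProjection (A z₀) ε) (transformed A z₀ ε z)

/-- The Riesz projections and the block decomposition behind Howland's multiplicity are what they
should be: `P(z₀)` is a projection of finite rank; near `z₀` the projection `P(z)` is analytic,
its contour lies in the resolvent set of `A z`, `T(z)` is boundedly invertible,
`T(z) A(z) T(z)⁻¹` is block diagonal with respect to `ran P(z₀) ∔ ran Q(z₀)`, the blocks `F` and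
`G` are analytic and `G(z)` is boundedly invertible. -/
structure HasRieszBlockDecomposition (A : ℂ → H →L[ℂ] H) (z₀ : ℂ) (ε : ℝ) : Prop where
  isIdempotentElem : IsIdempotentElem (rieszProjection (A z₀) ε)
  finiteDimensional : FiniteDimensional ℂ (rieszProjection (A z₀) ε).range
  contour : ∀ᶠ z in 𝓝 z₀, Metric.sphere (0 : ℂ) ε ⊆ resolventSet ℂ (A z)
  analyticAt_rieszProjection : AnalyticAt ℂ (fun z => rieszProjection (A z) ε) z₀
  isUnit_transformation : ∀ᶠ z in 𝓝 z₀, IsUnit (transformation A z₀ ε z)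
  block_diagonal : ∀ᶠ z in 𝓝 z₀,
    rieszProjection (A z₀) ε * transformed A z₀ ε z * (1 - rieszProjection (A z₀) ε) = 0 ∧
    (1 - rieszProjection (A z₀) ε) * transformed A z₀ ε z * rieszProjection (A z₀) ε = 0
  analyticAt_blockF : AnalyticAt ℂ (blockF A z₀ ε) z₀
  analyticAt_blockG : AnalyticAt ℂ (blockG A z₀ ε) z₀
  isUnit_blockG : ∀ᶠ z in 𝓝 z₀, IsUnit (blockG A z₀ ε z)

/-- Howland's multiplicity `ν(z₀; A(·))`: the order of vanishing at `z₀` of the determinant of the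
finite-dimensional block `F(·)` (equal to `⊤` if the determinant vanishes identically near `z₀`). -/
def howlandMultiplicity (A : ℂ → H →L[ℂ] H) (z₀ : ℂ) (ε : ℝ) : ℕ∞ :=
  analyticOrderAt (fun z => LinearMap.det (blockF A z₀ ε z).toLinearMap) z₀

end AnalyticFredholm

end

/-!
The number `ν` can be read off the Smith form of the block `F`, and the number `m_a` does not depend
on the factorization used to compute it. Both claims are reduced to analytic functions near `z₀`.

*Riesz projections.* Over a circle in the resolvent set of `B`, the Cauchy transform of the
resolvent continues `(B - w)⁻¹ (1 - P)` analytically into the disk (`inverse_mul_rieszProjection`).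
This makes `P` idempotent, and it inverts `B` on `ran (1 - P)` if `0` is the only spectral point in
the disk (`exists_inverse_on_complement`). Since inversion in the Banach algebra of continuous
operator functions on the circle is analytic, `P` depends analytically on `B`
(`analyticAt_rieszProjection`). For a Fredholm operator a quasi-inverse splits the resolvent near
`0` into an analytic and a compact part; so `P` is a compact projection, hence of finite rank
(`finiteDimensional_range_rieszProjection`).

*Existence.* Up to invertible analytic factors, `A` is `F ⊕ 1` with respect to `P(z₀)`
(`exists_factorization_transformed`). In a basis of `ran P(z₀)` the block `F` is an analytic matrix
function, invertible off `z₀`, and Gaussian elimination with pivots of least order brings it to the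
diagonal form `diag ((z - z₀) ^ kᵢ)` (`AnalyticEntriesAt.exists_smith_form`). This is a local Smith
form of `A`, and the order of `det F` is `∑ kᵢ` (`exists_hasLocalSmithForm`).

*Uniqueness.* For any local Smith form the sum of the exponents is the codimension of
`{A g | g analytic at z₀}` in the space of all vector functions analytic at `z₀`: the outer factors
act bijectively on that space, and for the middle factor the cokernel is described by the first
`n_j` Taylor coefficients in the direction of `P_j` (`HasLocalSmithForm.sum_eq_finrank`).
-/

namespace AnalyticFredholm

open Topology Metric

/-! ### Riesz projections -/

section Riesz

variable {H : Type*} [NormedAddCommGroup H] [InnerProductSpace ℂ H]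

lemma commute_ringInverse {M : Type*} [MonoidWithZero M] {a b : M} (h : Commute a b) :
    Commute a (Ring.inverse b) := by
  by_cases hb : IsUnit b
  · obtain ⟨u, rfl⟩ := hb
    rw [Ring.inverse_unit]
    exact h.units_inv_right
  · rw [Ring.inverse_non_unit _ hb]
    exact Commute.zero_right a

/-- A point of the resolvent set, in the sign convention `B - ζ` of the Riesz projection. -/
lemma isUnit_sub_smul_one_iff {B : H →L[ℂ] H} {ζ : ℂ} :
    IsUnit (B - ζ • (1 : H →L[ℂ] H)) ↔ ζ ∈ resolventSet ℂ B := by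
  rw [spectrum.mem_resolventSet_iff, ← IsUnit.neg_iff, neg_sub, Algebra.algebraMap_eq_smul_one]

lemma commute_inverse_sub_smul (B : H →L[ℂ] H) (ζ : ℂ) :
    Commute B (Ring.inverse (B - ζ • (1 : H →L[ℂ] H))) :=
  commute_ringInverse ((Commute.refl B).sub_right ((Commute.one_right B).smul_right ζ))

variable [CompleteSpace H]

lemma differentiableAt_inverse_sub_smul {B : H →L[ℂ] H} {ζ : ℂ} (h : ζ ∈ resolventSet ℂ B) :
    DifferentiableAt ℂ (fun ζ : ℂ => Ring.inverse (B - ζ • (1 : H →L[ℂ] H))) ζ := by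
  have h1 : DifferentiableAt ℂ (fun ζ : ℂ => B - ζ • (1 : H →L[ℂ] H)) ζ := by fun_prop
  exact (differentiableAt_inverse (isUnit_sub_smul_one_iff.2 h)).comp (𝕜 := ℂ) ζ h1

lemma continuousOn_inverse_sub_smul {B : H →L[ℂ] H} {s : Set ℂ} (h : s ⊆ resolventSet ℂ B) :
    ContinuousOn (fun ζ : ℂ => Ring.inverse (B - ζ • (1 : H →L[ℂ] H))) s :=
  fun _ hζ => (differentiableAt_inverse_sub_smul (h hζ)).continuousAt.continuousWithinAt

lemma map_circleIntegral {E F : Type*} [NormedAddCommGroup E]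
    [NormedSpace ℂ E] [CompleteSpace E] [NormedAddCommGroup F] [NormedSpace ℂ F] [CompleteSpace F]
    (L : E →L[ℂ] F) {f : ℂ → E} {c : ℂ} {r : ℝ} (hf : CircleIntegrable f c r) :
    L (circleIntegral f c r) = circleIntegral (fun ζ => L (f ζ)) c r := by
  have h := L.intervalIntegral_comp_comm hf.out
  simp only [circleIntegral, ← h, map_smul]

lemma circleIntegral_eq_of_annulus {E : Type*} [NormedAddCommGroup E] [NormedSpace ℂ E]
    [CompleteSpace E] {f : ℂ → E} {r R : ℝ} (hr : 0 < r) (hrR : r ≤ R)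
    (h : ∀ ζ : ℂ, r ≤ ‖ζ‖ → ‖ζ‖ ≤ R → DifferentiableAt ℂ f ζ) :
    circleIntegral f 0 R = circleIntegral f 0 r := by
  refine Complex.circleIntegral_eq_of_differentiable_on_annulus_off_countable hr hrR
    Set.countable_empty (fun ζ hζ => ?_) (fun ζ hζ => ?_)
  · simp only [Set.mem_sdiff, mem_closedBall, dist_zero_right, mem_ball, not_lt] at hζ
    exact (h ζ hζ.2 hζ.1).continuousAt.continuousWithinAt
  · simp only [Set.mem_sdiff, mem_closedBall, dist_zero_right, mem_ball, not_le] at hζ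
    exact h ζ hζ.1.2.le hζ.1.1.le

lemma rieszProjection_eq_of_annulus {B : H →L[ℂ] H} {r R : ℝ} (hr : 0 < r) (hrR : r ≤ R)
    (h : ∀ ζ : ℂ, r ≤ ‖ζ‖ → ‖ζ‖ ≤ R → ζ ∈ resolventSet ℂ B) :
    rieszProjection B R = rieszProjection B r := by
  unfold rieszProjection
  rw [circleIntegral_eq_of_annulus hr hrR
    fun ζ h1 h2 => differentiableAt_inverse_sub_smul (h ζ h1 h2)]

lemma circleIntegrable_inverse_sub_smul {B : H →L[ℂ] H} {r : ℝ} (hr : 0 ≤ r)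
    (h : sphere (0 : ℂ) r ⊆ resolventSet ℂ B) :
    CircleIntegrable (fun ζ : ℂ => Ring.inverse (B - ζ • (1 : H →L[ℂ] H))) 0 r :=
  (continuousOn_inverse_sub_smul h).circleIntegrable hr

lemma commute_circleIntegral {B : H →L[ℂ] H} {f : ℂ → H →L[ℂ] H} {r : ℝ}
    (hf : CircleIntegrable f 0 r) (h : ∀ ζ, Commute B (f ζ)) :
    Commute B (circleIntegral f 0 r) := by
  have h1 := map_circleIntegral
    (ContinuousLinearMap.mul ℂ (H →L[ℂ] H) B) hf
  have h2 := map_circleIntegral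
    ((ContinuousLinearMap.mul ℂ (H →L[ℂ] H)).flip B) hf
  simp only [ContinuousLinearMap.mul_apply', ContinuousLinearMap.flip_apply] at h1 h2
  rw [Commute, SemiconjBy, h1, h2]
  simp only [(h _).eq]

lemma commute_rieszProjection {B : H →L[ℂ] H} {r : ℝ} (hr : 0 ≤ r)
    (h : sphere (0 : ℂ) r ⊆ resolventSet ℂ B) : Commute B (rieszProjection B r) :=
  (commute_circleIntegral (circleIntegrable_inverse_sub_smul hr h)
    (commute_inverse_sub_smul B)).smul_right _

/-- The Cauchy transform `w ↦ (2πi)⁻¹ ∮ (ζ - w)⁻¹ (B - ζ)⁻¹ dζ` of the resolvent over the circle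
`|ζ| = R`. Inside the circle it continues `(B - w)⁻¹ (1 - P)` analytically across the spectrum,
`P` being the Riesz projection. -/
noncomputable def resolventTransform (B : H →L[ℂ] H) (R : ℝ) (w : ℂ) : H →L[ℂ] H :=
  (2 * Real.pi * Complex.I : ℂ)⁻¹ •
    circleIntegral (fun ζ : ℂ => (ζ - w)⁻¹ • Ring.inverse (B - ζ • (1 : H →L[ℂ] H))) 0 R

lemma analyticOnNhd_resolventTransform {B : H →L[ℂ] H} {R : ℝ} (hR : 0 < R)
    (h : sphere (0 : ℂ) R ⊆ resolventSet ℂ B) :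
    AnalyticOnNhd ℂ (resolventTransform B R) (ball 0 R) := by
  lift R to NNReal using hR.le
  have := (hasFPowerSeriesOn_cauchy_integral (c := (0 : ℂ)) (R := R)
    (circleIntegrable_inverse_sub_smul hR.le h) (by exact_mod_cast hR)).analyticOnNhd
  rwa [Metric.eball_coe] at this

lemma continuousOn_sub_inv_smul {E : Type*} [NormedAddCommGroup E] [NormedSpace ℂ E] {f : ℂ → E}
    {R : ℝ} {w : ℂ} (hw : w ∈ ball (0 : ℂ) R) (hf : ContinuousOn f (sphere 0 R)) :
    ContinuousOn (fun ζ : ℂ => (ζ - w)⁻¹ • f ζ) (sphere 0 R) := by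
  refine ContinuousOn.smul (ContinuousOn.inv₀ (by fun_prop) fun ζ hζ h => ?_) hf
  rw [sub_eq_zero] at h
  subst h
  simp only [mem_ball, mem_sphere] at hw hζ
  exact hw.ne hζ

lemma commute_resolventTransform {B : H →L[ℂ] H} {R : ℝ} (hR : 0 ≤ R)
    (h : sphere (0 : ℂ) R ⊆ resolventSet ℂ B) {w : ℂ} (hw : w ∈ ball (0 : ℂ) R) :
    Commute B (resolventTransform B R w) :=
  (commute_circleIntegral ((continuousOn_sub_inv_smul hw
    (continuousOn_inverse_sub_smul h)).circleIntegrable hR)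
    fun ζ => (commute_inverse_sub_smul B ζ).smul_right _).smul_right _

/-- The first resolvent identity, integrated over the circle: inside it `(B - w)⁻¹ (1 - P)` is the
Cauchy transform of the resolvent. -/
lemma inverse_mul_rieszProjection {B : H →L[ℂ] H} {R : ℝ} (hR : 0 ≤ R)
    (h : sphere (0 : ℂ) R ⊆ resolventSet ℂ B) {w : ℂ} (hw : w ∈ ball (0 : ℂ) R)
    (hwB : w ∈ resolventSet ℂ B) :
    Ring.inverse (B - w • (1 : H →L[ℂ] H)) * rieszProjection B R =
      Ring.inverse (B - w • (1 : H →L[ℂ] H)) - resolventTransform B R w := by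
  set X := Ring.inverse (B - w • (1 : H →L[ℂ] H)) with hX
  have hwu := isUnit_sub_smul_one_iff.2 hwB
  have h1 := map_circleIntegral
    (ContinuousLinearMap.mul ℂ (H →L[ℂ] H) X) (circleIntegrable_inverse_sub_smul hR h)
  simp only [ContinuousLinearMap.mul_apply'] at h1
  have h2 : circleIntegral (fun ζ : ℂ => X * Ring.inverse (B - ζ • (1 : H →L[ℂ] H))) 0 R =
      circleIntegral (fun ζ : ℂ => (ζ - w)⁻¹ • Ring.inverse (B - ζ • (1 : H →L[ℂ] H)) -
        (ζ - w)⁻¹ • X) 0 R := by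
    refine circleIntegral.integral_congr hR fun ζ hζ => ?_
    have hζu := isUnit_sub_smul_one_iff.2 (h hζ)
    have hne : ζ - w ≠ 0 := by
      rw [sub_ne_zero]
      rintro rfl
      simp only [mem_ball, mem_sphere] at hw hζ
      exact hw.ne hζ
    set Y := Ring.inverse (B - ζ • (1 : H →L[ℂ] H)) with hY
    have e1 : Y - X = (ζ - w) • (X * Y) := by
      have : X * ((B - w • (1 : H →L[ℂ] H)) - (B - ζ • (1 : H →L[ℂ] H))) * Y = Y - X := by
        rw [mul_sub, Ring.inverse_mul_cancel _ hwu, sub_mul, one_mul, mul_assoc,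
          Ring.mul_inverse_cancel _ hζu, mul_one]
      rw [← this, sub_sub_sub_cancel_left, ← sub_smul]
      simp
    simp only [← smul_sub]
    rw [e1, inv_smul_smul₀ hne]
  rw [circleIntegral.integral_sub
    ((continuousOn_sub_inv_smul hw (continuousOn_inverse_sub_smul h)).circleIntegrable hR)
    ((continuousOn_sub_inv_smul hw continuousOn_const).circleIntegrable hR),
    circleIntegral.integral_smul_const, circleIntegral.integral_sub_inv_of_mem_ball hw] at h2
  have hpi : (2 * Real.pi * Complex.I : ℂ) ≠ 0 := by
    simp [Real.pi_ne_zero]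
  rw [rieszProjection, mul_smul_comm, h1, h2, resolventTransform, smul_sub, smul_smul, neg_div,
    one_div, neg_mul, inv_mul_cancel₀ hpi]
  simp only [neg_smul, one_smul]
  abel

lemma exists_annulus_subset_resolventSet {B : H →L[ℂ] H} {r : ℝ}
    (h : sphere (0 : ℂ) r ⊆ resolventSet ℂ B) :
    ∃ R, r < R ∧ ∀ ζ : ℂ, r ≤ ‖ζ‖ → ‖ζ‖ ≤ R → ζ ∈ resolventSet ℂ B := by
  rcases lt_or_ge r 0 with hr | hr
  · exact ⟨r / 2, by linarith, fun ζ h1 h2 => absurd (norm_nonneg ζ) (by linarith)⟩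
  obtain ⟨δ, hδ, hs⟩ := (isCompact_sphere (0 : ℂ) r).exists_cthickening_subset_open
    (spectrum.isOpen_resolventSet (𝕜 := ℂ) B) h
  refine ⟨r + δ, by linarith, fun ζ h1 h2 => hs ?_⟩
  rcases eq_or_ne ζ 0 with rfl | h0
  · have : r = 0 := le_antisymm (by simpa using h1) hr
    subst this
    exact self_subset_cthickening _ (by simp)
  have hpos : (0 : ℝ) < ‖ζ‖ := norm_pos_iff.2 h0
  refine mem_cthickening_of_dist_le ζ ((r / ‖ζ‖ : ℝ) • ζ) δ _ ?_ ?_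
  · simp [abs_of_nonneg hr, hpos.ne']
  · have : ζ - (r / ‖ζ‖ : ℝ) • ζ = (1 - r / ‖ζ‖ : ℝ) • ζ := by rw [sub_smul, one_smul]
    rw [dist_eq_norm, this, norm_smul, Real.norm_eq_abs,
      abs_of_nonneg (by rw [sub_nonneg]; exact div_le_one_of_le₀ h1 hpos.le), sub_mul, one_mul,
      div_mul_cancel₀ _ hpos.ne']
    linarith

/-- A Riesz projection is idempotent: with `P` computed over a slightly larger circle,
`(B - w)⁻¹ P` differs from `(B - w)⁻¹` by a function analytic in the disk. -/
theorem isIdempotentElem_rieszProjection {B : H →L[ℂ] H} {r : ℝ} (hr : 0 < r)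
    (h : sphere (0 : ℂ) r ⊆ resolventSet ℂ B) : IsIdempotentElem (rieszProjection B r) := by
  obtain ⟨R, hrR, hann⟩ := exists_annulus_subset_resolventSet h
  have hR : 0 < R := hr.trans hrR
  have hsR : sphere (0 : ℂ) R ⊆ resolventSet ℂ B := fun ζ hζ => by
    rw [mem_sphere_zero_iff_norm] at hζ
    exact hann ζ (by linarith) hζ.le
  have hsub : closedBall (0 : ℂ) r ⊆ ball 0 R := closedBall_subset_ball hrR
  have han := analyticOnNhd_resolventTransform hR hsR
  have h0 : circleIntegral (resolventTransform B R) 0 r = 0 :=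
    Complex.circleIntegral_eq_zero_of_differentiable_on_off_countable hr.le Set.countable_empty
      (han.continuousOn.mono hsub)
      fun ζ hζ => (han ζ (hsub (ball_subset_closedBall hζ.1))).differentiableAt
  have h1 := map_circleIntegral
    ((ContinuousLinearMap.mul ℂ (H →L[ℂ] H)).flip (rieszProjection B r))
    (circleIntegrable_inverse_sub_smul hr.le h)
  simp only [ContinuousLinearMap.mul_apply', ContinuousLinearMap.flip_apply] at h1
  rw [← rieszProjection_eq_of_annulus hr hrR.le hann] at h1
  rw [circleIntegral.integral_congr hr.le (g := fun ζ =>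
      Ring.inverse (B - ζ • (1 : H →L[ℂ] H)) - resolventTransform B R ζ)
      (fun ζ hζ => inverse_mul_rieszProjection hR.le hsR (hsub (sphere_subset_closedBall hζ))
        (h hζ)),
    circleIntegral.integral_sub (circleIntegrable_inverse_sub_smul hr.le h)
      ((han.continuousOn.mono (sphere_subset_closedBall.trans hsub)).circleIntegrable hr.le),
    h0, sub_zero, rieszProjection_eq_of_annulus hr hrR.le hann] at h1
  rw [IsIdempotentElem]
  conv_lhs => enter [1]; rw [rieszProjection]
  rw [smul_mul_assoc, h1, rieszProjection]

end Riesz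

section RieszAnalytic

variable {H : Type*} [NormedAddCommGroup H] [InnerProductSpace ℂ H]

variable {B : H →L[ℂ] H} {r : ℝ}

lemma sphere_subset_resolventSet (hr : 0 < r)
    (h : ∀ ζ ∈ closedBall (0 : ℂ) r, ζ ≠ 0 → ζ ∈ resolventSet ℂ B) :
    sphere (0 : ℂ) r ⊆ resolventSet ℂ B := fun ζ hζ =>
  h ζ (sphere_subset_closedBall hζ) (ne_of_mem_sphere hζ hr.ne')

lemma isCompactOperator_of_finiteDimensional_range {K : H →L[ℂ] H}
    (hK : FiniteDimensional ℂ K.range) : IsCompactOperator K := by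
  have : ProperSpace K.range := FiniteDimensional.proper ℂ _
  exact (isCompactOperator_of_locallyCompactSpace_rng K.range.subtypeL).comp_clm
    (K.codRestrict K.range (fun x => ⟨x, rfl⟩))

lemma finiteDimensional_range_of_isCompactOperator {P : H →L[ℂ] H} (hP : IsIdempotentElem P)
    (hc : IsCompactOperator P) : FiniteDimensional ℂ P.range := by
  have hfix (x : P.range) : P x = x := by
    obtain ⟨y, hy⟩ := x.2
    rw [← hy]
    exact congr($hP y)
  have hcl : IsClosed (P.range : Set H) := by
    have : (P.range : Set H) = {x | P x = x} := by
      ext x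
      exact ⟨fun hx => hfix ⟨x, hx⟩, fun hx => ⟨x, hx⟩⟩
    rw [this]
    exact isClosed_eq P.continuous continuous_id
  have h1 : IsCompactOperator (P.codRestrict P.range (fun x => ⟨x, rfl⟩) ∘L P.range.subtypeL) :=
    (hc.codRestrict (fun x => LinearMap.mem_range_self P.toLinearMap x) hcl).comp_clm
      P.range.subtypeL
  refine FiniteDimensional.of_isCompactOperator_id (𝕜 := ℂ) ?_
  have h2 : (P.codRestrict P.range (fun x => LinearMap.mem_range_self P.toLinearMap x) ∘L
      P.range.subtypeL : P.range → P.range) = id := funext fun x => Subtype.ext (hfix x)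
  rw [← h2]
  exact h1

variable [CompleteSpace H]

/-- Integration over the circle `|ζ| = r` as a continuous linear map on the Banach space of
continuous functions on this circle. -/
noncomputable def circleIntegralCLM (E : Type*) [NormedAddCommGroup E] [NormedSpace ℂ E] (r : ℝ)
    (hr : 0 ≤ r) : C(sphere (0 : ℂ) r, E) →L[ℂ] E :=
  LinearMap.mkContinuous
    { toFun := fun f => circleIntegral (Function.extend Subtype.val f 0) 0 r
      map_add' := fun f g => by
        have hint (f : C(sphere (0 : ℂ) r, E)) :
            CircleIntegrable (Function.extend Subtype.val f 0) 0 r := by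
          refine ContinuousOn.circleIntegrable hr ?_
          rw [continuousOn_iff_continuous_domRestrict]
          convert f.continuous
          ext x
          simp
        rw [← circleIntegral.integral_add (hint f) (hint g)]
        refine circleIntegral.integral_congr hr fun ζ hζ => ?_
        lift ζ to sphere (0 : ℂ) r using hζ
        simp
      map_smul' := fun c f => by
        rw [RingHom.id_apply, ← circleIntegral.integral_smul]
        refine circleIntegral.integral_congr hr fun ζ hζ => ?_
        lift ζ to sphere (0 : ℂ) r using hζ
        simp }
    (2 * Real.pi * r) (fun f => by
      refine circleIntegral.norm_integral_le_of_norm_le_const hr (fun ζ hζ => ?_)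
      lift ζ to sphere (0 : ℂ) r using hζ
      simpa using f.norm_coe_le_norm ζ)

lemma circleIntegralCLM_apply {E : Type*} [NormedAddCommGroup E] [NormedSpace ℂ E] {r : ℝ}
    (hr : 0 ≤ r) (f : C(sphere (0 : ℂ) r, E)) {g : ℂ → E} (h : ∀ ζ, f ζ = g ζ) :
    circleIntegralCLM E r hr f = circleIntegral g 0 r := by
  refine circleIntegral.integral_congr hr fun ζ hζ => ?_
  lift ζ to sphere (0 : ℂ) r using hζ
  simp [h]

/-- The constant functions, as a continuous linear map into the Banach algebra of continuous
functions on the circle. -/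
noncomputable def constCLM (X E : Type*) [TopologicalSpace X] [CompactSpace X]
    [NormedAddCommGroup E] [NormedSpace ℂ E] : E →L[ℂ] C(X, E) :=
  LinearMap.mkContinuous
    { toFun := fun e => ContinuousMap.const X e
      map_add' := fun _ _ => rfl
      map_smul' := fun _ _ => rfl } 1
    (fun e => by
      rw [one_mul]
      exact (ContinuousMap.norm_le _ (norm_nonneg e)).2 fun _ => le_rfl)

/-- The function `ζ ↦ B - ζ` on the circle `|ζ| = r`. -/
noncomputable def resolventPencil (r : ℝ) (B : H →L[ℂ] H) : C(sphere (0 : ℂ) r, H →L[ℂ] H) :=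
  constCLM _ _ B - ⟨fun ζ => (ζ : ℂ) • (1 : H →L[ℂ] H), by fun_prop⟩

lemma isUnit_resolventPencil_iff {r : ℝ} {B : H →L[ℂ] H} :
    IsUnit (resolventPencil r B) ↔ sphere (0 : ℂ) r ⊆ resolventSet ℂ B := by
  rw [ContinuousMap.isUnit_iff_forall_isUnit]
  refine ⟨fun h ζ hζ => isUnit_sub_smul_one_iff.1 (h ⟨ζ, hζ⟩),
    fun h ζ => isUnit_sub_smul_one_iff.2 (h ζ.2)⟩

lemma analyticAt_resolventPencil (r : ℝ) (B : H →L[ℂ] H) :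
    AnalyticAt ℂ (resolventPencil (H := H) r) B :=
  ((constCLM (sphere (0 : ℂ) r) (H →L[ℂ] H)).analyticAt B).sub analyticAt_const

lemma eventually_sphere_subset_resolventSet {r : ℝ} {B : H →L[ℂ] H}
    (h : sphere (0 : ℂ) r ⊆ resolventSet ℂ B) :
    ∀ᶠ B' in 𝓝 B, sphere (0 : ℂ) r ⊆ resolventSet ℂ B' := by
  filter_upwards [(analyticAt_resolventPencil r B).continuousAt.eventually_mem
    (Units.isOpen.mem_nhds (isUnit_resolventPencil_iff.2 h))] with B' hB'
  exact isUnit_resolventPencil_iff.1 hB'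

lemma rieszProjection_eq_circleIntegralCLM {r : ℝ} (hr : 0 ≤ r) {B : H →L[ℂ] H}
    (h : sphere (0 : ℂ) r ⊆ resolventSet ℂ B) :
    rieszProjection B r = (-1 / (2 * (Real.pi : ℂ) * Complex.I)) •
      circleIntegralCLM _ r hr (Ring.inverse (resolventPencil r B)) := by
  rw [rieszProjection, circleIntegralCLM_apply]
  intro ζ
  obtain ⟨u, hu⟩ := isUnit_resolventPencil_iff.2 h
  have hζ : B - (ζ : ℂ) • (1 : H →L[ℂ] H) = resolventPencil r B ζ := rfl
  rw [hζ, ← hu, Ring.inverse_unit]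
  have : IsUnit ((u : C(sphere (0 : ℂ) r, H →L[ℂ] H)) ζ) :=
    (ContinuousMap.isUnit_iff_forall_isUnit _).1 u.isUnit ζ
  refine this.mul_left_cancel ?_
  rw [Ring.mul_inverse_cancel _ this, ← ContinuousMap.mul_apply, Units.mul_inv,
    ContinuousMap.one_apply]

lemma analyticAt_ringInverse {A : Type*} [NormedRing A] [NormedAlgebra ℂ A] [CompleteSpace A]
    {a : A} (ha : IsUnit a) : AnalyticAt ℂ (Ring.inverse : A → A) a := by
  obtain ⟨u, rfl⟩ := ha
  exact analyticAt_inverse u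

/-- The Riesz projection depends analytically on the operator: it is obtained from it by an
affine map, an inversion in the Banach algebra of continuous operator functions on the circle, and
the integral. -/
theorem analyticAt_rieszProjection {r : ℝ} (hr : 0 ≤ r) {B : H →L[ℂ] H}
    (h : sphere (0 : ℂ) r ⊆ resolventSet ℂ B) :
    AnalyticAt ℂ (fun B : H →L[ℂ] H => rieszProjection B r) B := by
  have h1 := (((circleIntegralCLM (H →L[ℂ] H) r hr).analyticAt _).comp
    ((analyticAt_ringInverse (isUnit_resolventPencil_iff.2 h)).comp
      (analyticAt_resolventPencil r B))).const_smul (c := -1 / (2 * (Real.pi : ℂ) * Complex.I))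
  refine h1.congr ?_
  filter_upwards [eventually_sphere_subset_resolventSet h] with B' hB'
  exact (rieszProjection_eq_circleIntegralCLM hr hB').symm

/-- If `0` is the only possible spectral point in the disk, then `B` is invertible on the range of
`1 - P`, with an inverse obtained from the analytic continuation of `(B - w)⁻¹ (1 - P)`. -/
lemma exists_inverse_on_complement (hr : 0 < r)
    (h : ∀ ζ ∈ closedBall (0 : ℂ) r, ζ ≠ 0 → ζ ∈ resolventSet ℂ B) :
    ∃ S, B * S = 1 - rieszProjection B r ∧ S * B = 1 - rieszProjection B r := by
  have hs := sphere_subset_resolventSet hr h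
  have h0 : (0 : ℂ) ∈ ball (0 : ℂ) r := mem_ball_self hr
  have key : B * resolventTransform B r 0 = 1 - rieszProjection B r := by
    have hc : ContinuousAt (fun w : ℂ => (B - w • (1 : H →L[ℂ] H)) * resolventTransform B r w) 0 :=
      ContinuousAt.mul (by fun_prop)
        (analyticOnNhd_resolventTransform hr hs 0 h0).continuousAt
    have h1 : Filter.Tendsto
        (fun w : ℂ => (B - w • (1 : H →L[ℂ] H)) * resolventTransform B r w) (𝓝[≠] 0)
        (𝓝 (B * resolventTransform B r 0)) := by
      have := hc.tendsto.mono_left (nhdsWithin_le_nhds (s := {0}ᶜ))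
      simpa using this
    refine tendsto_nhds_unique h1 (tendsto_const_nhds.congr' ?_)
    filter_upwards [self_mem_nhdsWithin, mem_nhdsWithin_of_mem_nhds (isOpen_ball.mem_nhds h0)]
      with w hw hwr
    have hwB := h w (ball_subset_closedBall hwr) hw
    have hwu := isUnit_sub_smul_one_iff.2 hwB
    have h2 := inverse_mul_rieszProjection hr.le hs hwr hwB
    have h3 : resolventTransform B r w =
        Ring.inverse (B - w • (1 : H →L[ℂ] H)) * (1 - rieszProjection B r) := by
      rw [mul_sub, h2]; simp
    rw [h3, ← mul_assoc, Ring.mul_inverse_cancel _ hwu, one_mul]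
  exact ⟨_, key, by rw [← (commute_resolventTransform hr.le hs h0).eq, key]⟩

/-- An integral of compact operators is compact. -/
lemma isCompactOperator_circleIntegral {f : ℂ → (H →L[ℂ] H)} (hr : 0 ≤ r)
    (hf : ContinuousOn f (sphere 0 r)) (hc : ∀ ζ ∈ sphere (0 : ℂ) r, IsCompactOperator (f ζ)) :
    IsCompactOperator (circleIntegral f 0 r : H →L[ℂ] H) := by
  have hcl : IsClosed (compactOperator (RingHom.id ℂ) H H : Set (H →L[ℂ] H)) :=
    isClosed_setOfPred_isCompactOperator
  have hint : CircleIntegrable f 0 r := hf.circleIntegrable hr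
  -- A closed subspace is the kernel of its quotient map, which commutes with the integral.
  have h1 := map_circleIntegral
    (compactOperator (RingHom.id ℂ) H H).mkQL hint
  rw [circleIntegral.integral_congr (f := fun ζ => (compactOperator _ H H).mkQL (f ζ)) hr
    (g := fun _ => 0) fun ζ hζ => (Submodule.Quotient.mk_eq_zero _).2 (hc ζ hζ)] at h1
  have h2 : circleIntegral f 0 r ∈ compactOperator (RingHom.id ℂ) H H := by
    rw [← Submodule.Quotient.mk_eq_zero]
    simpa [circleIntegral] using h1
  exact h2

/-- The Riesz projection of a Fredholm operator at an isolated point `0` of its spectrum has finite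
rank: up to a function analytic at `0`, the resolvent takes compact values. -/
theorem finiteDimensional_range_rieszProjection (hr : 0 < r)
    (h : ∀ ζ ∈ closedBall (0 : ℂ) r, ζ ≠ 0 → ζ ∈ resolventSet ℂ B) (hB : B.IsFredholm) :
    FiniteDimensional ℂ (rieszProjection B r).range := by
  refine finiteDimensional_range_of_isCompactOperator
    (isIdempotentElem_rieszProjection hr (sphere_subset_resolventSet hr h)) ?_
  obtain ⟨L, hL, -⟩ := hB.exists_isQuasiInverse
  -- The resolvent is `(1 - ζ L)⁻¹ L + (1 - ζ L)⁻¹ K (B - ζ)⁻¹` with `K` of finite rank; the first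
  -- summand is analytic for small `ζ` and does not contribute to the integral.
  set K : H →L[ℂ] H := 1 - L * B with hK
  have hKc : IsCompactOperator K := by
    have h1 : (L.toLinearMap ∘ₗ B.toLinearMap - LinearMap.id).HasFiniteRange :=
      LinearMap.FiniteRangeSetoid.equiv_iff_hasFiniteRange.1 hL
    refine isCompactOperator_of_finiteDimensional_range ?_
    have h2 : K.toLinearMap = -(L.toLinearMap ∘ₗ B.toLinearMap - LinearMap.id) := by
      ext x; simp [hK]
    rw [h2]
    exact Module.Finite.iff_fg.2 (LinearMap.hasFiniteRange_iff_range.1 h1.neg)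
  have hopen : ∀ᶠ ζ : ℂ in 𝓝 0, IsUnit (1 - ζ • L) := by
    have hc : ContinuousAt (fun ζ : ℂ => 1 - ζ • L) 0 := by fun_prop
    exact hc.eventually_mem (Units.isOpen.mem_nhds (by simp))
  obtain ⟨δ, hδ, hball⟩ := nhds_basis_closedBall.mem_iff.1 hopen
  have hs : 0 < min δ r := lt_min hδ hr
  set s := min δ r
  have hsr : ∀ ζ ∈ closedBall (0 : ℂ) s, ζ ≠ 0 → ζ ∈ resolventSet ℂ B := fun ζ hζ =>
    h ζ (closedBall_subset_closedBall (min_le_right _ _) hζ)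
  have hsu : ∀ ζ ∈ closedBall (0 : ℂ) s, IsUnit (1 - ζ • L) := fun ζ hζ =>
    hball (closedBall_subset_closedBall (min_le_left _ _) hζ)
  rw [rieszProjection_eq_of_annulus hs (min_le_right δ r) fun ζ h1 h2 =>
    h ζ (by simpa using h2) (norm_pos_iff.1 (hs.trans_le h1)), rieszProjection]
  have hd : ∀ ζ ∈ closedBall (0 : ℂ) s,
      DifferentiableAt ℂ (fun ζ : ℂ => Ring.inverse (1 - ζ • L)) ζ := fun ζ hζ => by
    have h1 : DifferentiableAt ℂ (fun ζ : ℂ => 1 - ζ • L) ζ := by fun_prop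
    exact (differentiableAt_inverse (hsu ζ hζ)).comp (𝕜 := ℂ) ζ h1
  have hcont : ContinuousOn (fun ζ : ℂ => Ring.inverse (1 - ζ • L)) (closedBall 0 s) :=
    fun ζ hζ => (hd ζ hζ).continuousAt.continuousWithinAt
  have hres := continuousOn_inverse_sub_smul (sphere_subset_resolventSet hs hsr)
  have heq : Set.EqOn (fun ζ : ℂ => Ring.inverse (B - ζ • (1 : H →L[ℂ] H)))
      (fun ζ => Ring.inverse (1 - ζ • L) * L +
        Ring.inverse (1 - ζ • L) * K * Ring.inverse (B - ζ • (1 : H →L[ℂ] H)))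
      (sphere (0 : ℂ) s) := fun ζ hζ => by
    have h1 := isUnit_sub_smul_one_iff.2 (sphere_subset_resolventSet hs hsr hζ)
    have h2 := hsu ζ (sphere_subset_closedBall hζ)
    have h3 : L * (B - ζ • (1 : H →L[ℂ] H)) = (1 - ζ • L) - K := by
      rw [hK, mul_sub, mul_smul_comm, mul_one]; abel
    refine h1.mul_right_cancel (h2.mul_left_cancel ?_)
    beta_reduce
    rw [Ring.inverse_mul_cancel _ h1, mul_one, add_mul, mul_assoc _ L, h3,
      mul_assoc _ _ (B - ζ • (1 : H →L[ℂ] H)), Ring.inverse_mul_cancel _ h1, mul_one, ← mul_add,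
      sub_add_cancel, ← mul_assoc, Ring.mul_inverse_cancel _ h2, one_mul]
  have hc1 : ContinuousOn (fun ζ : ℂ => Ring.inverse (1 - ζ • L) * L) (sphere 0 s) :=
    (hcont.mono sphere_subset_closedBall).mul continuousOn_const
  have hc2 : ContinuousOn (fun ζ : ℂ => Ring.inverse (1 - ζ • L) * K *
      Ring.inverse (B - ζ • (1 : H →L[ℂ] H))) (sphere 0 s) :=
    ((hcont.mono sphere_subset_closedBall).mul continuousOn_const).mul hres
  have hz : circleIntegral (fun ζ : ℂ => Ring.inverse (1 - ζ • L) * L) 0 s = 0 :=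
    Complex.circleIntegral_eq_zero_of_differentiable_on_off_countable hs.le Set.countable_empty
      (hcont.mul continuousOn_const)
      (fun ζ hζ => (hd ζ (ball_subset_closedBall hζ.1)).mul_const L)
  rw [circleIntegral.integral_congr hs.le heq,
    circleIntegral.integral_add (hc1.circleIntegrable hs.le) (hc2.circleIntegrable hs.le),
    hz, zero_add]
  refine IsCompactOperator.smul (S := ℂ)
    (isCompactOperator_circleIntegral hs.le hc2 fun ζ _ => ?_) _
  exact (hKc.clm_comp _).comp_clm _

end RieszAnalytic

/-! ### Compressions to the range of a projection -/

section Block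

variable {H : Type*} [NormedAddCommGroup H] [InnerProductSpace ℂ H]

lemma compress_apply (P M : H →L[ℂ] H) (x : P.range) : (compress P M x : H) = P (M x) := rfl

lemma apply_range_of_isIdempotentElem {P : H →L[ℂ] H} (hP : IsIdempotentElem P) (x : P.range) :
    P x = x := by
  obtain ⟨y, hy⟩ := x.2
  rw [← hy]
  exact congr($hP y)

lemma compress_mul {P : H →L[ℂ] H} (hP : IsIdempotentElem P) (M : H →L[ℂ] H) {N : H →L[ℂ] H}
    (hN : Commute P N) : compress P (M * N) = compress P M * compress P N := by
  ext x
  have h1 : P (N x) = N x := by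
    have := congr($(hN.eq) (x : H))
    simpa [apply_range_of_isIdempotentElem hP] using this
  simp [compress_apply, h1]

lemma compress_self {P : H →L[ℂ] H} (hP : IsIdempotentElem P) : compress P P = 1 := by
  ext x
  simp [compress_apply, apply_range_of_isIdempotentElem hP]

lemma isUnit_compress {P M S : H →L[ℂ] H} (hP : IsIdempotentElem P) (hMS : M * S = P)
    (hSM : S * M = P) : IsUnit (compress P M) := by
  have hM : Commute P M := by
    rw [Commute, SemiconjBy]
    nth_rw 1 [← hMS]
    rw [mul_assoc, hSM]
  have hS : Commute P S := by
    rw [Commute, SemiconjBy]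
    nth_rw 1 [← hSM]
    rw [mul_assoc, hMS]
  refine ⟨⟨compress P M, compress P S, ?_, ?_⟩, rfl⟩
  · rw [← compress_mul hP _ hS, hMS, compress_self hP]
  · rw [← compress_mul hP _ hM, hSM, compress_self hP]

lemma analyticAt_compress (P M : H →L[ℂ] H) : AnalyticAt ℂ (compress P) M := by
  exact ((ContinuousLinearMap.compL ℂ P.range H P.range
    (P.codRestrict P.range fun x => ⟨x, rfl⟩)).comp
      ((ContinuousLinearMap.compL ℂ P.range H H).flip P.range.subtypeL)).analyticAt M

/-- If `M` is invertible on the range of `1 - P`, its block there, completed by the identity on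
the range of `P`, is invertible. -/
lemma isUnit_add_one_sub_mul {R : Type*} [Ring R] {P M S : R} (hP : IsIdempotentElem P)
    (hMS : M * S = 1 - P) (hSM : S * M = 1 - P) : IsUnit (P + (1 - P) * M * (1 - P)) := by
  have aux {M S : R} (hMS : M * S = 1 - P) (hSM : S * M = 1 - P) :
      (P + (1 - P) * M * (1 - P)) * (P + (1 - P) * S * (1 - P)) = 1 := by
    have h1 : P * ((1 - P) * S * (1 - P)) = 0 := by
      rw [← mul_assoc, ← mul_assoc, hP.mul_one_sub_self, zero_mul, zero_mul]
    have h2 : (1 - P) * M * (1 - P) * P = 0 := by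
      rw [mul_assoc, hP.one_sub_mul_self, mul_zero]
    have h3 : (1 - P) * M * (1 - P) * ((1 - P) * S * (1 - P)) = 1 - P := by
      calc (1 - P) * M * (1 - P) * ((1 - P) * S * (1 - P))
          = (1 - P) * M * ((1 - P) * (1 - P)) * S * (1 - P) := by simp only [mul_assoc]
        _ = (1 - P) * M * (S * M) * S * (1 - P) := by rw [hP.one_sub.eq, hSM]
        _ = (1 - P) * (M * S) * (M * S) * (1 - P) := by simp only [mul_assoc]
        _ = 1 - P := by rw [hMS, hP.one_sub.eq, hP.one_sub.eq, hP.one_sub.eq]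
    rw [add_mul, mul_add, mul_add, hP.eq, h1, h2, h3, add_zero, zero_add, add_sub_cancel]
  exact ⟨⟨_, _, aux hMS hSM, aux hSM hMS⟩, rfl⟩

/-- An operator commuting with `P` is the product of its two diagonal blocks, each completed by the
identity. -/
lemma add_mul_add_eq_of_commute {R : Type*} [Ring R] {P X : R} (hP : IsIdempotentElem P)
    (h : Commute P X) : (P * X * P + (1 - P)) * (P + (1 - P) * X * (1 - P)) = X := by
  have h1 : P * X * P * ((1 - P) * X * (1 - P)) = 0 := by
    rw [mul_assoc, ← mul_assoc P, ← mul_assoc P, hP.mul_one_sub_self, zero_mul, zero_mul, mul_zero]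
  have h2 : P * X * P * P = P * X := by rw [mul_assoc, hP.eq, h.eq, mul_assoc, hP.eq]
  have h3 : (1 - P) * ((1 - P) * X * (1 - P)) = (1 - P) * X := by
    have h' : Commute (1 - P) X := (Commute.one_left X).sub_left h
    rw [← mul_assoc, ← mul_assoc, hP.one_sub.eq, h'.eq, mul_assoc, hP.one_sub.eq]
  rw [add_mul, mul_add, mul_add, h1, h2, h3, hP.one_sub_mul_self, add_zero, zero_add, ← add_mul,
    add_sub_cancel, one_mul]

variable [CompleteSpace H]

/-! ### The block decomposition -/

variable {A : ℂ → H →L[ℂ] H} {z₀ : ℂ} {ε : ℝ}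

lemma analyticAt_rieszProjection_comp (hA : AnalyticAt ℂ A z₀) (hε : 0 ≤ ε)
    (hs : sphere (0 : ℂ) ε ⊆ resolventSet ℂ (A z₀)) :
    AnalyticAt ℂ (fun z => rieszProjection (A z) ε) z₀ :=
  (analyticAt_rieszProjection hε hs).comp hA

lemma analyticAt_transformation (hA : AnalyticAt ℂ A z₀) (hε : 0 ≤ ε)
    (hs : sphere (0 : ℂ) ε ⊆ resolventSet ℂ (A z₀)) :
    AnalyticAt ℂ (transformation A z₀ ε) z₀ := by
  have h := analyticAt_rieszProjection_comp hA hε hs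
  exact (analyticAt_const.mul h).add (analyticAt_const.mul (analyticAt_const.sub h))

lemma transformation_self (hε : 0 < ε) (hs : sphere (0 : ℂ) ε ⊆ resolventSet ℂ (A z₀)) :
    transformation A z₀ ε z₀ = 1 := by
  have hP := isIdempotentElem_rieszProjection hε hs
  rw [transformation, hP.eq, hP.one_sub.eq, add_sub_cancel]

lemma analyticAt_ringInverse_transformation (hA : AnalyticAt ℂ A z₀) (hε : 0 < ε)
    (hs : sphere (0 : ℂ) ε ⊆ resolventSet ℂ (A z₀)) :
    AnalyticAt ℂ (fun z => Ring.inverse (transformation A z₀ ε z)) z₀ :=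
  (analyticAt_ringInverse (by rw [transformation_self hε hs]; exact isUnit_one)).comp
    (analyticAt_transformation hA hε.le hs)

lemma analyticAt_transformed (hA : AnalyticAt ℂ A z₀) (hε : 0 < ε)
    (hs : sphere (0 : ℂ) ε ⊆ resolventSet ℂ (A z₀)) :
    AnalyticAt ℂ (transformed A z₀ ε) z₀ :=
  ((analyticAt_transformation hA hε.le hs).mul hA).mul
    (analyticAt_ringInverse_transformation hA hε hs)

lemma transformed_self (hε : 0 < ε) (hs : sphere (0 : ℂ) ε ⊆ resolventSet ℂ (A z₀)) :
    transformed A z₀ ε z₀ = A z₀ := by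
  rw [transformed, transformation_self hε hs, Ring.inverse_one, one_mul, mul_one]

lemma eventually_isUnit {R : Type*} [NormedRing R] [CompleteSpace R] {f : ℂ → R}
    (hf : ContinuousAt f z₀) (h : IsUnit (f z₀)) : ∀ᶠ z in 𝓝 z₀, IsUnit (f z) :=
  hf.eventually_mem (Units.isOpen.mem_nhds h)

lemma eventually_isUnit_transformation (hA : AnalyticAt ℂ A z₀) (hε : 0 < ε)
    (hs : sphere (0 : ℂ) ε ⊆ resolventSet ℂ (A z₀)) :
    ∀ᶠ z in 𝓝 z₀, IsUnit (transformation A z₀ ε z) :=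
  eventually_isUnit (analyticAt_transformation hA hε.le hs).continuousAt
    (by rw [transformation_self hε hs]; exact isUnit_one)

/-- `T(z)` intertwines `P(z)` and `P(z₀)`, and `P(z)` commutes with `A z`; hence
`T(z) A(z) T(z)⁻¹` commutes with `P(z₀)`. -/
lemma commute_transformed {z : ℂ} (hε : 0 < ε)
    (hs₀ : sphere (0 : ℂ) ε ⊆ resolventSet ℂ (A z₀))
    (hs : sphere (0 : ℂ) ε ⊆ resolventSet ℂ (A z)) (hT : IsUnit (transformation A z₀ ε z)) :
    Commute (rieszProjection (A z₀) ε) (transformed A z₀ ε z) := by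
  have hP₀ := isIdempotentElem_rieszProjection hε hs₀
  have hP := isIdempotentElem_rieszProjection hε hs
  have hc := commute_rieszProjection hε.le hs
  have hPT : rieszProjection (A z₀) ε * transformation A z₀ ε z =
      transformation A z₀ ε z * rieszProjection (A z) ε := by
    rw [transformation, mul_add, add_mul, ← mul_assoc, ← mul_assoc, hP₀.eq, mul_assoc _ _
      (rieszProjection (A z) ε), mul_assoc _ _ (rieszProjection (A z) ε), hP.eq,
      hP₀.mul_one_sub_self, hP.one_sub_mul_self, zero_mul, mul_zero]
  rw [transformed]
  obtain ⟨u, hu⟩ := hT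
  rw [← hu] at hPT ⊢
  rw [Ring.inverse_unit, Commute, SemiconjBy]
  have h2 : (↑u⁻¹ : H →L[ℂ] H) * rieszProjection (A z₀) ε = rieszProjection (A z) ε * ↑u⁻¹ := by
    rw [Units.inv_mul_eq_iff_eq_mul, ← mul_assoc, Units.eq_mul_inv_iff_mul_eq]
    exact hPT
  rw [mul_assoc (_ * A z), h2, ← mul_assoc, ← mul_assoc, hPT, mul_assoc (u : H →L[ℂ] H), ← hc.eq]
  simp only [mul_assoc]

lemma eventually_commute_transformed (hA : AnalyticAt ℂ A z₀) (hε : 0 < ε)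
    (hs : sphere (0 : ℂ) ε ⊆ resolventSet ℂ (A z₀)) :
    ∀ᶠ z in 𝓝 z₀, Commute (rieszProjection (A z₀) ε) (transformed A z₀ ε z) := by
  filter_upwards [hA.continuousAt.eventually (eventually_sphere_subset_resolventSet hs),
    eventually_isUnit_transformation hA hε hs] with z h1 h2
  exact commute_transformed hε hs h1 h2

theorem hasRieszBlockDecomposition (hA : AnalyticAt ℂ A z₀) (hfred : (A z₀).IsFredholm)
    (hε : 0 < ε) (hiso : ∀ ζ ∈ closedBall (0 : ℂ) ε, ζ ≠ 0 → ζ ∈ resolventSet ℂ (A z₀)) :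
    HasRieszBlockDecomposition A z₀ ε := by
  have hs := sphere_subset_resolventSet hε hiso
  have hP := isIdempotentElem_rieszProjection hε hs
  have hX := analyticAt_transformed hA hε hs
  refine ⟨hP, finiteDimensional_range_rieszProjection hε hiso hfred,
    hA.continuousAt.eventually (eventually_sphere_subset_resolventSet hs),
    analyticAt_rieszProjection_comp hA hε.le hs, eventually_isUnit_transformation hA hε hs, ?_,
    (analyticAt_compress _ _).comp hX, (analyticAt_compress _ _).comp hX, ?_⟩
  · filter_upwards [eventually_commute_transformed hA hε hs] with z hz
    constructor
    · rw [hz.eq, mul_assoc, mul_sub, mul_one, hP.eq, sub_self, mul_zero]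
    · rw [mul_assoc, ← hz.eq, ← mul_assoc, sub_mul, one_mul, hP.eq, sub_self, zero_mul]
  · obtain ⟨S, hS1, hS2⟩ := exists_inverse_on_complement hε hiso
    have hcl : IsClosed ((1 - rieszProjection (A z₀) ε).range : Set H) :=
      ContinuousLinearMap.IsIdempotentElem.isClosed_range hP.one_sub
    have : CompleteSpace (1 - rieszProjection (A z₀) ε).range := hcl.completeSpace_coe
    have hG : AnalyticAt ℂ (blockG A z₀ ε) z₀ := (analyticAt_compress _ _).comp hX
    have hu : IsUnit (blockG A z₀ ε z₀) := by
      rw [blockG, transformed_self hε hs]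
      exact isUnit_compress hP.one_sub hS1 hS2
    exact eventually_isUnit (f := blockG A z₀ ε) hG.continuousAt hu

/-- Near `z₀` the function `A` factors through the block `P(z₀) X(z) P(z₀)` of its transform
`X(z)`, up to invertible analytic factors. -/
theorem exists_factorization_transformed (hA : AnalyticAt ℂ A z₀)
    (hε : 0 < ε) (hiso : ∀ ζ ∈ closedBall (0 : ℂ) ε, ζ ≠ 0 → ζ ∈ resolventSet ℂ (A z₀)) :
    ∃ E₁ E₂ : ℂ → H →L[ℂ] H, AnalyticAt ℂ E₁ z₀ ∧ AnalyticAt ℂ E₂ z₀ ∧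
      IsUnit (E₁ z₀) ∧ IsUnit (E₂ z₀) ∧
      ∀ᶠ z in 𝓝 z₀, A z = E₁ z * (rieszProjection (A z₀) ε * transformed A z₀ ε z *
        rieszProjection (A z₀) ε + (1 - rieszProjection (A z₀) ε)) * E₂ z := by
  have hs := sphere_subset_resolventSet hε hiso
  have hP := isIdempotentElem_rieszProjection hε hs
  have hX := analyticAt_transformed hA hε hs
  obtain ⟨S, hS1, hS2⟩ := exists_inverse_on_complement hε hiso
  set P := rieszProjection (A z₀) ε with hPdef
  refine ⟨fun z => Ring.inverse (transformation A z₀ ε z),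
    fun z => (P + (1 - P) * transformed A z₀ ε z * (1 - P)) * transformation A z₀ ε z,
    analyticAt_ringInverse_transformation hA hε hs,
    (analyticAt_const.add ((analyticAt_const.mul hX).mul analyticAt_const)).mul
      (analyticAt_transformation hA hε.le hs), ?_, ?_, ?_⟩
  · simp [transformation_self hε hs]
  · beta_reduce
    rw [transformation_self hε hs, mul_one, transformed_self hε hs]
    exact isUnit_add_one_sub_mul hP hS1 hS2
  · filter_upwards [eventually_isUnit_transformation hA hε hs,
      eventually_commute_transformed hA hε hs] with z hT hc
    rw [← mul_assoc, mul_assoc (Ring.inverse _), add_mul_add_eq_of_commute hP hc, transformed,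
      ← mul_assoc, ← mul_assoc, Ring.inverse_mul_cancel _ hT, one_mul,
      Ring.inverse_mul_cancel_right _ _ hT]

end Block

/-! ### Smith form of analytic matrix functions -/

section Smith

variable {l m n o : Type*} {z₀ : ℂ}

/-- All entries of the matrix function `M` are analytic at `z₀`. -/
def AnalyticEntriesAt (M : ℂ → Matrix m n ℂ) (z₀ : ℂ) : Prop :=
  ∀ i j, AnalyticAt ℂ (fun z => M z i j) z₀

namespace AnalyticEntriesAt

lemma mul [Fintype m] {M : ℂ → Matrix l m ℂ} {N : ℂ → Matrix m n ℂ} (hM : AnalyticEntriesAt M z₀)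
    (hN : AnalyticEntriesAt N z₀) : AnalyticEntriesAt (fun z => M z * N z) z₀ := fun i j => by
  simp only [Matrix.mul_apply]
  exact Finset.analyticAt_fun_sum _ fun k _ => (hM i k).mul (hN k j)

lemma sub {M N : ℂ → Matrix m n ℂ} (hM : AnalyticEntriesAt M z₀)
    (hN : AnalyticEntriesAt N z₀) : AnalyticEntriesAt (fun z => M z - N z) z₀ := fun i j =>
  (hM i j).sub (hN i j)

lemma smul {f : ℂ → ℂ} {M : ℂ → Matrix m n ℂ} (hf : AnalyticAt ℂ f z₀)
    (hM : AnalyticEntriesAt M z₀) : AnalyticEntriesAt (fun z => f z • M z) z₀ := fun i j =>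
  hf.mul (hM i j)

lemma const (M : Matrix m n ℂ) : AnalyticEntriesAt (fun _ => M) z₀ := fun _ _ => analyticAt_const

lemma fromBlocks {M₁ : ℂ → Matrix l n ℂ} {M₂ : ℂ → Matrix l o ℂ} {M₃ : ℂ → Matrix m n ℂ}
    {M₄ : ℂ → Matrix m o ℂ} (h₁ : AnalyticEntriesAt M₁ z₀) (h₂ : AnalyticEntriesAt M₂ z₀)
    (h₃ : AnalyticEntriesAt M₃ z₀) (h₄ : AnalyticEntriesAt M₄ z₀) :
    AnalyticEntriesAt (fun z => Matrix.fromBlocks (M₁ z) (M₂ z) (M₃ z) (M₄ z)) z₀ := by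
  rintro (i | i) (j | j)
  exacts [h₁ i j, h₂ i j, h₃ i j, h₄ i j]

lemma submatrix {M : ℂ → Matrix m n ℂ} (hM : AnalyticEntriesAt M z₀) (f : l → m) (g : o → n) :
    AnalyticEntriesAt (fun z => (M z).submatrix f g) z₀ := fun i j => hM (f i) (g j)

lemma det [Fintype m] [DecidableEq m] {M : ℂ → Matrix m m ℂ} (hM : AnalyticEntriesAt M z₀) :
    AnalyticAt ℂ (fun z => (M z).det) z₀ := by
  simp only [Matrix.det_apply']
  exact Finset.analyticAt_fun_sum _ fun σ _ => analyticAt_const.mul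
    (Finset.analyticAt_fun_prod _ fun i _ => hM _ _)

end AnalyticEntriesAt

/-- Elimination with a nonzero pivot. -/
lemma fromBlocks_eq_mul_of_pivot [Fintype m] [DecidableEq m] {a : ℂ} (ha : a ≠ 0)
    (b : Matrix Unit m ℂ) (c : Matrix m Unit ℂ) (D : Matrix m m ℂ) :
    Matrix.fromBlocks (a • (1 : Matrix Unit Unit ℂ)) b c D =
      Matrix.fromBlocks 1 0 (a⁻¹ • c) 1 *
        Matrix.fromBlocks (a • (1 : Matrix Unit Unit ℂ)) 0 0 (D - a⁻¹ • (c * b)) *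
        Matrix.fromBlocks 1 (a⁻¹ • b) 0 1 := by
  simp [Matrix.fromBlocks_multiply, smul_smul, ha]

/-- The entries of an analytic matrix function which does not vanish identically have a common
factor `(z - z₀) ^ k` such that, after division, some entry is nonzero at `z₀`. -/
lemma AnalyticEntriesAt.exists_eq_pow_smul [Finite m] [Finite n] {M : ℂ → Matrix m n ℂ}
    (hM : AnalyticEntriesAt M z₀) (h0 : ¬ ∀ᶠ z in 𝓝 z₀, M z = 0) :
    ∃ (k : ℕ) (N : ℂ → Matrix m n ℂ) (i : m) (j : n), AnalyticEntriesAt N z₀ ∧ N z₀ i j ≠ 0 ∧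
      ∀ᶠ z in 𝓝 z₀, M z = (z - z₀) ^ k • N z := by
  have hex : ∃ p : m × n, analyticOrderAt (fun z => M z p.1 p.2) z₀ ≠ ⊤ := by
    by_contra! hcon
    refine h0 ?_
    have : ∀ p : m × n, ∀ᶠ z in 𝓝 z₀, M z p.1 p.2 = 0 := fun p =>
      analyticOrderAt_eq_top.1 (hcon p)
    filter_upwards [Filter.eventually_all.2 this] with z hz
    ext i j
    exact hz (i, j)
  obtain ⟨p₀, hp₀⟩ := hex
  have : Nonempty (m × n) := ⟨p₀⟩
  obtain ⟨p, hp⟩ := Finite.exists_min fun p : m × n => analyticOrderAt (fun z => M z p.1 p.2) z₀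
  obtain ⟨k, hk⟩ := ENat.ne_top_iff_exists.1 (ne_top_of_le_ne_top hp₀ (hp p₀))
  have hdiv : ∀ i j, ∃ g : ℂ → ℂ, AnalyticAt ℂ g z₀ ∧
      ∀ᶠ z in 𝓝 z₀, M z i j = (z - z₀) ^ k • g z := fun i j =>
    (natCast_le_analyticOrderAt (hM i j)).1 (hk ▸ hp (i, j))
  choose g hg hgM using hdiv
  refine ⟨k, fun z => Matrix.of fun i j => g i j z, p.1, p.2, fun i j => hg i j, ?_, ?_⟩
  · have h1 : analyticOrderAt (fun z => M z p.1 p.2) z₀ = k + analyticOrderAt (g p.1 p.2) z₀ := by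
      rw [analyticOrderAt_congr (hgM p.1 p.2)]
      have h2 : AnalyticAt ℂ (fun z : ℂ => z - z₀) z₀ := analyticAt_id.sub analyticAt_const
      change analyticOrderAt ((fun z : ℂ => z - z₀) ^ k * g p.1 p.2) z₀ = _
      rw [analyticOrderAt_mul (h2.pow k) (hg _ _), analyticOrderAt_centeredMonomial]
    rw [← hk] at h1
    have h3 : analyticOrderAt (g p.1 p.2) z₀ = 0 := by
      have h4 : analyticOrderAt (g p.1 p.2) z₀ ≠ ⊤ := fun h => by simp [h] at h1
      lift analyticOrderAt (g p.1 p.2) z₀ to ℕ using h4 with q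
      norm_cast at h1 ⊢
      omega
    exact (hg _ _).analyticOrderAt_eq_zero.1 h3
  · filter_upwards [Filter.eventually_all.2 fun i => Filter.eventually_all.2 (hgM i)] with z hz
    ext i j
    exact hz i j

/-- **Smith normal form** of a square analytic matrix function, invertible off `z₀`, over the
discrete valuation ring of germs at `z₀`: an entry of least order serves as a pivot. -/
theorem AnalyticEntriesAt.exists_smith_form : ∀ (n : ℕ) {M : ℂ → Matrix (Fin n) (Fin n) ℂ},
    AnalyticEntriesAt M z₀ → (∀ᶠ z in 𝓝[≠] z₀, IsUnit (M z)) →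
    ∃ (U V : ℂ → Matrix (Fin n) (Fin n) ℂ) (d : Fin n → ℕ), AnalyticEntriesAt U z₀ ∧
      AnalyticEntriesAt V z₀ ∧ IsUnit (U z₀) ∧ IsUnit (V z₀) ∧
      ∀ᶠ z in 𝓝 z₀, M z = U z * Matrix.diagonal (fun i => (z - z₀) ^ d i) * V z
  | 0, M, _, _ => ⟨fun _ => 1, fun _ => 1, fun _ => 0, .const _, .const _, isUnit_one, isUnit_one,
      .of_forall fun _ => Subsingleton.elim _ _⟩
  | n + 1, M, hM, hu => by
    have h0 : ¬ ∀ᶠ z in 𝓝 z₀, M z = 0 := fun h0 => by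
      obtain ⟨z, hz1, hz2⟩ := (hu.and (h0.filter_mono nhdsWithin_le_nhds)).exists
      rw [hz2] at hz1
      exact not_isUnit_zero hz1
    obtain ⟨k, N, i, j, hN, hij, hMN⟩ := hM.exists_eq_pow_smul h0
    -- `e i` singles out the index `i`, so that `N'` has the pivot in its upper left corner.
    let e (i : Fin (n + 1)) : Fin (n + 1) ≃ Unit ⊕ Fin n :=
      (finSuccEquiv' i).trans ((Equiv.optionEquivSumPUnit _).trans (Equiv.sumComm _ _))
    have he : ∀ i, (e i).symm (Sum.inl ()) = i := fun i => by simp [e]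
    let N' : ℂ → Matrix (Unit ⊕ Fin n) (Unit ⊕ Fin n) ℂ := fun z =>
      (N z).submatrix (e i).symm (e j).symm
    let a : ℂ → ℂ := fun z => N z i j
    -- the Schur complement of the pivot
    let S : ℂ → Matrix (Fin n) (Fin n) ℂ := fun z =>
      (N' z).toBlocks₂₂ - (a z)⁻¹ • ((N' z).toBlocks₂₁ * (N' z).toBlocks₁₂)
    have ha : AnalyticAt ℂ a z₀ := hN i j
    have hainv : AnalyticAt ℂ (fun z => (a z)⁻¹) z₀ := ha.inv hij
    have ha0 : ∀ᶠ z in 𝓝 z₀, a z ≠ 0 := ha.continuousAt.eventually_ne hij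
    have hN' : AnalyticEntriesAt N' z₀ := hN.submatrix _ _
    have h12 : AnalyticEntriesAt (fun z => (N' z).toBlocks₁₂) z₀ := fun _ _ => hN' _ _
    have h21 : AnalyticEntriesAt (fun z => (N' z).toBlocks₂₁) z₀ := fun _ _ => hN' _ _
    have h22 : AnalyticEntriesAt (fun z => (N' z).toBlocks₂₂) z₀ := fun _ _ => hN' _ _
    have hS : AnalyticEntriesAt S z₀ := h22.sub (.smul hainv (h21.mul h12))
    have hfac : ∀ᶠ z in 𝓝 z₀, N' z = Matrix.fromBlocks 1 0 ((a z)⁻¹ • (N' z).toBlocks₂₁) 1 *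
        Matrix.fromBlocks (a z • (1 : Matrix Unit Unit ℂ)) 0 0 (S z) *
        Matrix.fromBlocks 1 ((a z)⁻¹ • (N' z).toBlocks₁₂) 0 1 := by
      filter_upwards [ha0] with z hz
      rw [← fromBlocks_eq_mul_of_pivot hz]
      conv_lhs => rw [← Matrix.fromBlocks_toBlocks (N' z)]
      congr
      ext ⟨⟩ ⟨⟩
      simp [Matrix.toBlocks₁₁, N', a, he]
    have hSu : ∀ᶠ z in 𝓝[≠] z₀, IsUnit (S z) := by
      filter_upwards [hu, hMN.filter_mono nhdsWithin_le_nhds, hfac.filter_mono nhdsWithin_le_nhds]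
        with z h1 h2 h3
      have h4 : IsUnit (N z).det := by
        rw [h2, Matrix.isUnit_iff_isUnit_det, Matrix.det_smul] at h1
        exact isUnit_of_mul_isUnit_right h1
      have h5 : IsUnit (N' z) := by
        rw [← Matrix.isUnit_iff_isUnit_det] at h4
        exact (Matrix.isUnit_submatrix_equiv _ _).2 h4
      rw [h3, Matrix.isUnit_iff_isUnit_det] at h5
      simp only [Matrix.det_mul, Matrix.det_fromBlocks_zero₁₂, Matrix.det_fromBlocks_zero₂₁,
        Matrix.det_one, one_mul, mul_one] at h5
      rw [Matrix.isUnit_iff_isUnit_det]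
      exact isUnit_of_mul_isUnit_right h5
    obtain ⟨U, V, d, hU, hV, hU0, hV0, hSUV⟩ := exists_smith_form n hS hSu
    let U' : ℂ → Matrix (Unit ⊕ Fin n) (Unit ⊕ Fin n) ℂ := fun z =>
      Matrix.fromBlocks 1 0 ((a z)⁻¹ • (N' z).toBlocks₂₁) 1 *
        Matrix.fromBlocks (a z • (1 : Matrix Unit Unit ℂ)) 0 0 (U z)
    let V' : ℂ → Matrix (Unit ⊕ Fin n) (Unit ⊕ Fin n) ℂ := fun z =>
      Matrix.fromBlocks 1 0 0 (V z) * Matrix.fromBlocks 1 ((a z)⁻¹ • (N' z).toBlocks₁₂) 0 1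
    let d' : Unit ⊕ Fin n → ℕ := Sum.elim (fun _ => k) (fun i => k + d i)
    refine ⟨fun z => (U' z).submatrix (e i) (e i), fun z => (V' z).submatrix (e i) (e j),
      d' ∘ e i, ?_, ?_, ?_, ?_, ?_⟩
    · exact AnalyticEntriesAt.submatrix (((AnalyticEntriesAt.const 1).fromBlocks (.const 0)
        (.smul hainv h21) (.const 1)).mul ((AnalyticEntriesAt.smul ha (.const 1)).fromBlocks
        (.const 0) (.const 0) hU)) _ _
    · exact AnalyticEntriesAt.submatrix (((AnalyticEntriesAt.const 1).fromBlocks (.const 0)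
        (.const 0) hV).mul ((AnalyticEntriesAt.const 1).fromBlocks
        (.smul hainv h12) (.const 0) (.const 1))) _ _
    · rw [Matrix.isUnit_submatrix_equiv, Matrix.isUnit_iff_isUnit_det]
      rw [Matrix.isUnit_iff_isUnit_det] at hU0
      simpa [U', a, hij] using hU0
    · rw [Matrix.isUnit_submatrix_equiv, Matrix.isUnit_iff_isUnit_det]
      rw [Matrix.isUnit_iff_isUnit_det] at hV0
      simpa [V'] using hV0
    · filter_upwards [hMN, hfac, hSUV] with z h1 h2 h3
      have hd : (Matrix.diagonal fun x => (z - z₀) ^ d' x) =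
          (z - z₀) ^ k • Matrix.fromBlocks (1 : Matrix Unit Unit ℂ) 0 0
            (Matrix.diagonal fun x => (z - z₀) ^ d x) := by
        rw [Matrix.fromBlocks_smul, smul_zero, smul_zero, ← Matrix.diagonal_one,
          ← Matrix.diagonal_smul, ← Matrix.diagonal_smul, Matrix.fromBlocks_diagonal]
        congr 1
        ext (x | x) <;> simp [d', pow_add]
      have hN'' : (z - z₀) ^ k • N' z =
          U' z * Matrix.diagonal (fun x => (z - z₀) ^ d' x) * V' z := by
        rw [hd, h2, h3]
        simp only [U', V', Matrix.mul_smul, Matrix.smul_mul, Matrix.mul_assoc]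
        congr 2
        simp [Matrix.fromBlocks_multiply]
      have h4 : M z = ((z - z₀) ^ k • N' z).submatrix (e i) (e j) := by
        rw [h1]; ext x y; simp [N']
      rw [h4, hN'', ← Matrix.submatrix_mul_equiv _ _ (e i) (e i) (e j),
        ← Matrix.submatrix_mul_equiv _ _ (e i) (e i) (e i), Matrix.submatrix_diagonal_equiv]
      rfl

end Smith

/-! ### The codimension of the image of an analytic operator function -/

section Codimension

variable {H : Type*} [NormedAddCommGroup H] [InnerProductSpace ℂ H]

lemma analyticAt_clm_apply {E F : Type*} [NormedAddCommGroup E] [NormedSpace ℂ E]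
    [NormedAddCommGroup F] [NormedSpace ℂ F] {f : ℂ → E →L[ℂ] F} {g : ℂ → E} {z₀ : ℂ}
    (hf : AnalyticAt ℂ f z₀) (hg : AnalyticAt ℂ g z₀) : AnalyticAt ℂ (fun z => f z (g z)) z₀ :=
  ((ContinuousLinearMap.id ℂ (E →L[ℂ] F)).analyticAt_bilinear (f z₀, g z₀)).comp₂ hf hg

/-- The vector functions analytic at `z₀`. -/
def analyticFunctions (H : Type*) [NormedAddCommGroup H] [InnerProductSpace ℂ H] (z₀ : ℂ) :
    Submodule ℂ (ℂ → H) where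
  carrier := {f | AnalyticAt ℂ f z₀}
  add_mem' := AnalyticAt.add
  zero_mem' := analyticAt_const
  smul_mem' _ _ hf := hf.const_smul

/-- The functions which near `z₀` have the form `A(z) g(z)` with `g` analytic at `z₀`. The
dimension of its cokernel is the invariant that determines the algebraic multiplicity. -/
def analyticImage (A : ℂ → H →L[ℂ] H) (z₀ : ℂ) : Submodule ℂ (analyticFunctions H z₀) where
  carrier := {f | ∃ g : ℂ → H, AnalyticAt ℂ g z₀ ∧ ∀ᶠ z in 𝓝 z₀, f.1 z = A z (g z)}
  add_mem' := by
    rintro f f' ⟨g, hg, h⟩ ⟨g', hg', h'⟩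
    refine ⟨g + g', hg.add hg', ?_⟩
    filter_upwards [h, h'] with z hz hz'
    simp [hz, hz']
  zero_mem' := ⟨0, analyticAt_const, by simp⟩
  smul_mem' := by
    rintro c f ⟨g, hg, h⟩
    refine ⟨c • g, hg.const_smul, ?_⟩
    filter_upwards [h] with z hz
    simp [hz]

lemma exists_eq_smul_of_finrank_range_eq_one {P : H →L[ℂ] H} (hP : IsIdempotentElem P)
    (h1 : Module.finrank ℂ P.range = 1) :
    ∃ (φ : H →L[ℂ] ℂ) (v : H), φ v = 1 ∧ ∀ x, P x = φ x • v := by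
  have : FiniteDimensional ℂ P.range := .of_finrank_pos (by omega)
  let e : P.range ≃L[ℂ] ℂ := ContinuousLinearEquiv.ofFinrankEq (by simpa using h1)
  let π : H →L[ℂ] P.range :=
    P.codRestrict P.range (fun x => LinearMap.mem_range_self P.toLinearMap x)
  refine ⟨(e : P.range →L[ℂ] ℂ) ∘L π, e.symm 1, ?_, fun x => ?_⟩
  · have : π (e.symm 1) = e.symm 1 := Subtype.ext (apply_range_of_isIdempotentElem hP _)
    simp [this]
  · have : e (π x) • e.symm 1 = π x := by rw [← map_smul]; simp
    exact congr(($this : H)).symm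

/-- The derivatives at `z₀` of order less than `n j` of the scalar functions `z ↦ L j z (f z)`,
where the functionals `L j z` depend analytically on `z`; they stand in for Taylor coefficients. -/
noncomputable def taylorCoefficients {r : ℕ} (n : Fin r → ℕ) {z₀ : ℂ} {L : Fin r → ℂ → H →L[ℂ] ℂ}
    (hL : ∀ j, AnalyticAt ℂ (L j) z₀) :
    analyticFunctions H z₀ →ₗ[ℂ] ((j : Fin r) × Fin (n j) → ℂ) where
  toFun f p := iteratedDeriv p.2 (fun z => L p.1 z (f.1 z)) z₀
  map_add' f g := by
    ext p
    have hf := (analyticAt_clm_apply (hL p.1) f.2).contDiffAt (n := (p.2 : ℕ))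
    have hg := (analyticAt_clm_apply (hL p.1) g.2).contDiffAt (n := (p.2 : ℕ))
    simpa using iteratedDeriv_fun_add hf hg
  map_smul' c f := by
    ext p
    simp

lemma iteratedDeriv_sum_mul_sub_pow {n : ℕ} (c : Fin n → ℂ) (z₀ : ℂ) (i : Fin n) :
    iteratedDeriv i (fun z => ∑ k, c k * (z - z₀) ^ (k : ℕ)) z₀ = i.1.factorial * c i := by
  rw [iteratedDeriv_fun_sum fun k _ => by fun_prop]
  have h (k : Fin n) : iteratedDeriv i (fun z => c k * (z - z₀) ^ (k : ℕ)) z₀ =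
      if i = k then i.1.factorial * c i else 0 := by
    rw [iteratedDeriv_const_mul_field,
      iteratedDeriv_comp_sub_const (f := fun z : ℂ => z ^ (k : ℕ))]
    simp only [sub_self, iteratedDeriv_fun_pow_zero, Fin.val_inj]
    split_ifs with h
    · subst h; ring
    · simp
  simp [h]

variable [CompleteSpace H] {A : ℂ → H →L[ℂ] H} {z₀ : ℂ}

/-- The sum of the exponents of a local Smith form is the codimension of the image of `A` in the
space of analytic vector functions; so it depends on `A` only. -/
theorem HasLocalSmithForm.sum_eq_finrank {r : ℕ} {n : Fin r → ℕ} (h : HasLocalSmithForm A z₀ r n)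
    (hA : ∀ᶠ z in 𝓝[≠] z₀, IsUnit (A z)) :
    ∑ j, n j = Module.finrank ℂ (analyticFunctions H z₀ ⧸ analyticImage A z₀) := by
  obtain ⟨-, -, N, E₁, E₂, P₀, P, hN, hz₀, hE₁, hE₂, hu₁, hu₂, hP₀, hP, hP₀P, hPP, -, hrank,
    hfac⟩ := h
  have hmem : ∀ᶠ z in 𝓝 z₀, z ∈ N := hN.mem_nhds hz₀
  -- Off `z₀` the middle factor is invertible, which forces the projections to add up to `1`.
  have hsum : P₀ + ∑ j, P j = 1 := by
    obtain ⟨z, hz, hzN⟩ := (hA.and (hmem.filter_mono nhdsWithin_le_nhds)).exists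
    have hD : IsUnit (P₀ + ∑ j, (z - z₀) ^ n j • P j) := by
      obtain ⟨u₁, h₁⟩ := hu₁ z hzN
      obtain ⟨u₂, h₂⟩ := hu₂ z hzN
      rwa [hfac z hzN, ← h₁, ← h₂, Units.isUnit_mul_units, Units.isUnit_units_mul] at hz
    have h0 : (P₀ + ∑ j, (z - z₀) ^ n j • P j) * (1 - (P₀ + ∑ j, P j)) = 0 := by
      have h1 : P₀ * (P₀ + ∑ j, P j) = P₀ := by
        simp [mul_add, hP₀.eq, Finset.mul_sum, hP₀P]
      have h2 (i) : P i * (P₀ + ∑ j, P j) = P i := by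
        rw [mul_add, (hP₀P i).2, zero_add, Finset.mul_sum,
          Finset.sum_eq_single i (fun j _ hj => hPP i j hj.symm) (by simp), (hP i).eq]
      simp [mul_sub, add_mul, Finset.sum_mul, h1, h2]
    have := hD.mul_right_eq_zero.1 h0
    rw [sub_eq_zero] at this
    exact this.symm
  choose φ v hφv hφ using fun j => exists_eq_smul_of_finrank_range_eq_one (hP j) (hrank j)
  have hv0 : ∀ j, v j ≠ 0 := fun j hj => by simpa [hj] using hφv j
  have hφP₀ : ∀ j x, φ j (P₀ x) = 0 := fun j x => by
    have := congr($((hP₀P j).2) x)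
    simpa [hφ, hv0] using this
  have hφv' : ∀ i j, i ≠ j → φ i (v j) = 0 := fun i j hij => by
    have := congr($(hPP i j hij) (v j))
    simpa [hφ, hv0, hφv] using this
  have hφD : ∀ j z x, φ j ((P₀ + ∑ j, (z - z₀) ^ n j • P j) x) = (z - z₀) ^ n j * φ j x := by
    intro j z x
    simp only [add_apply, sum_apply, smul_apply, map_add,
      map_sum, map_smul, hφP₀, zero_add, hφ, smul_eq_mul]
    rw [Finset.sum_eq_single j (fun i _ hi => by rw [hφv' j i hi.symm]; ring) (by simp), hφv]
    ring
  have hE₁inv : AnalyticAt ℂ (fun z => Ring.inverse (E₁ z)) z₀ :=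
    (analyticAt_ringInverse (hu₁ z₀ hz₀)).comp (hE₁ z₀ hz₀)
  have hE₂inv : AnalyticAt ℂ (fun z => Ring.inverse (E₂ z)) z₀ :=
    (analyticAt_ringInverse (hu₂ z₀ hz₀)).comp (hE₂ z₀ hz₀)
  let L : Fin r → ℂ → H →L[ℂ] ℂ := fun j z => φ j ∘L Ring.inverse (E₁ z)
  have hL : ∀ j, AnalyticAt ℂ (L j) z₀ := fun j =>
    ((ContinuousLinearMap.compL ℂ H H ℂ (φ j)).analyticAt _).comp hE₁inv
  -- `f` is in the image iff the component of `E₁⁻¹ f` along `v j` vanishes to order `n j`.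
  have hker : LinearMap.ker (taylorCoefficients n hL) = analyticImage A z₀ := by
    ext f
    have hiff : f ∈ LinearMap.ker (taylorCoefficients n hL) ↔
        ∀ j, (n j : ℕ∞) ≤ analyticOrderAt (fun z => L j z (f.1 z)) z₀ := by
      simp only [natCast_le_analyticOrderAt_iff_iteratedDeriv_eq_zero
        (analyticAt_clm_apply (hL _) f.2)]
      refine ⟨fun hf j i hi => congr_fun hf ⟨j, ⟨i, hi⟩⟩, fun hf => funext fun p => ?_⟩
      exact hf p.1 p.2 p.2.2
    rw [hiff]
    constructor
    · intro hf
      choose g hg hgf using fun j =>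
        (natCast_le_analyticOrderAt (analyticAt_clm_apply (hL j) f.2)).1 (hf j)
      refine ⟨fun z => Ring.inverse (E₂ z) (P₀ (Ring.inverse (E₁ z) (f.1 z)) + ∑ j, g j z • v j),
        analyticAt_clm_apply hE₂inv
          ((analyticAt_clm_apply analyticAt_const (analyticAt_clm_apply hE₁inv f.2)).add
            (Finset.analyticAt_fun_sum _ fun j _ => (hg j).smul analyticAt_const)), ?_⟩
      filter_upwards [hmem, Filter.eventually_all.2 hgf] with z hz hgz
      set w := Ring.inverse (E₁ z) (f.1 z) with hw
      have hE₂z (x : H) : E₂ z (Ring.inverse (E₂ z) x) = x :=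
        congr($(Ring.mul_inverse_cancel _ (hu₂ z hz)) x)
      have hE₁z : E₁ z w = f.1 z := congr($(Ring.mul_inverse_cancel _ (hu₁ z hz)) (f.1 z))
      have hPv (i j) : P i (v j) = if i = j then v j else 0 := by
        rw [hφ]
        split_ifs with hij
        · subst hij; rw [hφv, one_smul]
        · rw [hφv' i j hij, zero_smul]
      have hP₀v (j) : P₀ (v j) = 0 := by
        have h1 : v j = P j (v j) := by simp [hPv]
        rw [h1]
        exact congr($((hP₀P j).1) (v j))
      have hPP₀w (i) : P i (P₀ w) = 0 := congr($((hP₀P i).2) w)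
      have hP₀w : P₀ (P₀ w) = P₀ w := congr($(hP₀.eq) w)
      have hgz' (j) : (z - z₀) ^ n j * g j z = φ j w := (hgz j).symm
      have hww : P₀ w + ∑ j, φ j w • v j = w := by
        simpa [hφ] using congr($hsum w)
      rw [hfac z hz]
      simp only [mul_apply_eq_comp, hE₂z, ← hE₁z]
      congr 1
      conv_lhs => rw [← hww]
      simp [hP₀w, hP₀v, hPP₀w, hPv, smul_smul, hgz']
    · rintro ⟨g, hg, hgf⟩ j
      rw [natCast_le_analyticOrderAt (analyticAt_clm_apply (hL j) f.2)]
      refine ⟨fun z => φ j (E₂ z (g z)), analyticAt_clm_apply analyticAt_const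
        (analyticAt_clm_apply (hE₂ z₀ hz₀) hg), ?_⟩
      filter_upwards [hmem, hgf] with z hz hgz
      have h1 : Ring.inverse (E₁ z) (A z (g z)) =
          (P₀ + ∑ j, (z - z₀) ^ n j • P j) (E₂ z (g z)) := by
        rw [hfac z hz, mul_assoc]
        have := Ring.inverse_mul_cancel_left _
          ((P₀ + ∑ j, (z - z₀) ^ n j • P j) * E₂ z) (hu₁ z hz)
        exact congr($this (g z))
      simp only [L, ContinuousLinearMap.comp_apply, hgz, h1, hφD, smul_eq_mul]
  have hsurj : Function.Surjective (taylorCoefficients n hL) := by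
    intro c
    let f : ℂ → H := fun z => E₁ z (∑ j, (∑ k : Fin (n j),
      ((k.1.factorial : ℂ)⁻¹ * c ⟨j, k⟩) * (z - z₀) ^ (k : ℕ)) • v j)
    have hf : AnalyticAt ℂ f z₀ := analyticAt_clm_apply (hE₁ z₀ hz₀)
      (Finset.analyticAt_fun_sum _ fun j _ => AnalyticAt.smul (by fun_prop) analyticAt_const)
    refine ⟨⟨f, hf⟩, funext fun ⟨i, k⟩ => ?_⟩
    have heq : (fun z => L i z (f z)) =ᶠ[𝓝 z₀] fun z => ∑ k : Fin (n i),
        ((k.1.factorial : ℂ)⁻¹ * c ⟨i, k⟩) * (z - z₀) ^ (k : ℕ) := by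
      filter_upwards [hmem] with z hz
      have h1 (x : H) : Ring.inverse (E₁ z) (E₁ z x) = x :=
        congr($(Ring.inverse_mul_cancel _ (hu₁ z hz)) x)
      simp only [L, f, ContinuousLinearMap.comp_apply, h1, map_sum, map_smul, smul_eq_mul]
      rw [Finset.sum_eq_single i (fun j _ hj => by rw [hφv' i j hj.symm, mul_zero]) (by simp), hφv,
        mul_one]
    change iteratedDeriv k (fun z => L i z (f z)) z₀ = _
    rw [heq.iteratedDeriv_eq, iteratedDeriv_sum_mul_sub_pow, mul_inv_cancel_left₀]
    exact_mod_cast k.1.factorial_ne_zero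
  rw [← hker, ((taylorCoefficients n hL).quotKerEquivOfSurjective hsurj).finrank_eq]
  simp

end Codimension

/-! ### Operators given by a matrix on the range of a finite rank projection -/

section Existence

variable {H : Type*} [NormedAddCommGroup H] [InnerProductSpace ℂ H]

section Lift

variable {P : H →L[ℂ] H} {d : ℕ} (b : Module.Basis (Fin d) ℂ P.range)

/-- The operator `P` as a map onto its range. -/
noncomputable def toRange (P : H →L[ℂ] H) : H →L[ℂ] P.range :=
  P.codRestrict P.range (fun x => LinearMap.mem_range_self P.toLinearMap x)

lemma coe_toRange (P : H →L[ℂ] H) (x : H) : (toRange P x : H) = P x := rfl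

lemma toRange_coe (hP : IsIdempotentElem P) (x : P.range) : toRange P x = x :=
  Subtype.ext (apply_range_of_isIdempotentElem hP x)

/-- The operator which is zero on `ker P` and has the matrix `m` on `ran P`, in the basis `b`. -/
noncomputable def ofMatrix : Matrix (Fin d) (Fin d) ℂ →ₗ[ℂ] H →L[ℂ] H where
  toFun m :=
    haveI := b.finiteDimensional_of_finite
    P.range.subtypeL ∘L (Matrix.toLin b b m).toContinuousLinearMap ∘L toRange P
  map_add' m m' := by ext x; simp
  map_smul' c m := by ext x; simp

lemma ofMatrix_apply (m : Matrix (Fin d) (Fin d) ℂ) (x : H) :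
    ofMatrix b m x = Matrix.toLin b b m (toRange P x) := rfl

lemma ofMatrix_mul (hP : IsIdempotentElem P) (m m' : Matrix (Fin d) (Fin d) ℂ) :
    ofMatrix b (m * m') = ofMatrix b m * ofMatrix b m' := by
  ext x
  rw [mul_apply_eq_comp, ofMatrix_apply, ofMatrix_apply, Matrix.toLin_mul b b b,
    LinearMap.comp_apply]
  congr 2
  exact (toRange_coe hP _).symm

lemma ofMatrix_one : ofMatrix b 1 = P := by
  ext x
  rw [ofMatrix_apply, Matrix.toLin_one, LinearMap.id_apply, coe_toRange]

lemma mul_ofMatrix (hP : IsIdempotentElem P) (m : Matrix (Fin d) (Fin d) ℂ) :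
    P * ofMatrix b m = ofMatrix b m := by
  nth_rw 1 [← ofMatrix_one b]
  rw [← ofMatrix_mul b hP, one_mul]

lemma ofMatrix_mul_self (hP : IsIdempotentElem P) (m : Matrix (Fin d) (Fin d) ℂ) :
    ofMatrix b m * P = ofMatrix b m := by
  nth_rw 2 [← ofMatrix_one b]
  rw [← ofMatrix_mul b hP, mul_one]

lemma ofMatrix_toMatrix_compress (X : H →L[ℂ] H) :
    ofMatrix b (LinearMap.toMatrix b b (compress P X).toLinearMap) = P * X * P := by
  ext x
  rw [ofMatrix_apply, Matrix.toLin_toMatrix]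
  rfl

lemma analyticAt_ofMatrix {M : ℂ → Matrix (Fin d) (Fin d) ℂ} {z₀ : ℂ}
    (hM : AnalyticEntriesAt M z₀) : AnalyticAt ℂ (fun z => ofMatrix b (M z)) z₀ := by
  have h (z) : ofMatrix b (M z) = ∑ i, ∑ j, M z i j • ofMatrix b (Matrix.single i j 1) := by
    conv_lhs => rw [Matrix.matrix_eq_sum_single (M z)]
    simp only [map_sum]
    refine Finset.sum_congr rfl fun i _ => Finset.sum_congr rfl fun j _ => ?_
    rw [← map_smul, Matrix.smul_single, smul_eq_mul, mul_one]
  simp only [h]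
  exact Finset.analyticAt_fun_sum _ fun i _ => Finset.analyticAt_fun_sum _ fun j _ =>
    (hM i j).smul analyticAt_const

/-- The operator which is the identity on `ker P` and has the matrix `m` on `ran P`. -/
noncomputable def ofMatrixHom (hP : IsIdempotentElem P) :
    Matrix (Fin d) (Fin d) ℂ →* H →L[ℂ] H where
  toFun m := ofMatrix b m + (1 - P)
  map_one' := by rw [ofMatrix_one, add_sub_cancel]
  map_mul' m m' := by
    have h1 : ofMatrix b m * (1 - P) = 0 := by
      rw [mul_sub, mul_one, ofMatrix_mul_self b hP, sub_self]
    have h2 : (1 - P) * ofMatrix b m' = 0 := by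
      rw [sub_mul, one_mul, mul_ofMatrix b hP, sub_self]
    rw [add_mul, mul_add, mul_add, ← ofMatrix_mul b hP, h1, h2, hP.one_sub.eq, add_zero, zero_add]

lemma ofMatrixHom_apply (hP : IsIdempotentElem P) (m : Matrix (Fin d) (Fin d) ℂ) :
    ofMatrixHom b hP m = ofMatrix b m + (1 - P) := rfl

lemma ofMatrixHom_mul_ofMatrix (hP : IsIdempotentElem P) (m m' : Matrix (Fin d) (Fin d) ℂ) :
    ofMatrixHom b hP m * ofMatrix b m' = ofMatrix b (m * m') := by
  rw [ofMatrixHom_apply, add_mul, sub_mul, one_mul, mul_ofMatrix b hP, sub_self, add_zero,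
    ofMatrix_mul b hP]

lemma ofMatrix_mul_ofMatrixHom (hP : IsIdempotentElem P) (m m' : Matrix (Fin d) (Fin d) ℂ) :
    ofMatrix b m * ofMatrixHom b hP m' = ofMatrix b (m * m') := by
  rw [ofMatrixHom_apply, mul_add, mul_sub, mul_one, ofMatrix_mul_self b hP, sub_self, add_zero,
    ofMatrix_mul b hP]

lemma finrank_range_ofMatrix_single (hP : IsIdempotentElem P) (i : Fin d) :
    Module.finrank ℂ (ofMatrix b (Matrix.single i i 1)).range = 1 := by
  have happ (x : P.range) : Matrix.toLin b b (Matrix.single i i 1) x = b.repr x i • b i := by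
    rw [Matrix.toLin_apply]
    simp [Matrix.single_mulVec, Function.update_apply]
  have hrange : (ofMatrix b (Matrix.single i i 1)).range = ℂ ∙ (b i : H) := by
    have happ' (y : H) : ofMatrix b (Matrix.single i i 1) y =
        b.repr (toRange P y) i • (b i : H) := by
      rw [ofMatrix_apply, happ]; rfl
    ext x
    rw [Submodule.mem_span_singleton]
    constructor
    · rintro ⟨y, rfl⟩
      exact ⟨_, (happ' y).symm⟩
    · rintro ⟨c, rfl⟩
      refine ⟨c • (b i : H), (happ' _).trans ?_⟩
      rw [map_smul, toRange_coe hP]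
      simp
  rw [hrange]
  refine finrank_span_singleton ?_
  have := b.ne_zero i
  simpa using this

lemma isUnit_toMatrix {F : P.range →L[ℂ] P.range} (hF : IsUnit F) :
    IsUnit (LinearMap.toMatrix b b F.toLinearMap) := by
  obtain ⟨u, rfl⟩ := hF
  refine ⟨⟨LinearMap.toMatrix b b (u : P.range →L[ℂ] P.range).toLinearMap,
    LinearMap.toMatrix b b (↑u⁻¹ : P.range →L[ℂ] P.range).toLinearMap, ?_, ?_⟩, rfl⟩
  · rw [← LinearMap.toMatrix_mul, ← LinearMap.toMatrix_one b]
    exact congr(LinearMap.toMatrix b b ($(u.mul_inv)).toLinearMap)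
  · rw [← LinearMap.toMatrix_mul, ← LinearMap.toMatrix_one b]
    exact congr(LinearMap.toMatrix b b ($(u.inv_mul)).toLinearMap)

end Lift

/-! ### Existence of the Smith form and the order of the determinant -/

section Exists

variable {A : ℂ → H →L[ℂ] H} {z₀ : ℂ} {ε : ℝ}

lemma isUnit_compress_of_commute {P X : H →L[ℂ] H} (hP : IsIdempotentElem P) (hX : IsUnit X)
    (h : Commute P X) : IsUnit (compress P X) := by
  have h1 : compress P 1 = 1 := by
    ext x
    simp [compress_apply, apply_range_of_isIdempotentElem hP]
  refine ⟨⟨compress P X, compress P (Ring.inverse X), ?_, ?_⟩, rfl⟩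
  · rw [← compress_mul hP _ (commute_ringInverse h), Ring.mul_inverse_cancel _ hX, h1]
  · rw [← compress_mul hP _ h, Ring.inverse_mul_cancel _ hX, h1]

variable [CompleteSpace H]

lemma sum_comp_equiv_subtype {ι κ M : Type*} [Fintype ι] [Fintype κ] [AddCommMonoid M]
    {p : ι → Prop} [DecidablePred p] (f : κ ≃ {i // p i}) (g : ι → M) :
    ∑ j, g (f j) = ∑ i, if p i then g i else 0 := by
  rw [f.sum_comp (fun x => g x), ← Finset.sum_filter]
  exact (Finset.sum_subtype _ (by simp) _).symm

/-- A factorization with diagonal middle factor on the range of a finite rank projection is a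
local Smith form, once the vanishing exponents are absorbed into the complementary projection and
the others are sorted. -/
lemma hasLocalSmithForm_of_diagonal {P : H →L[ℂ] H} (hP : IsIdempotentElem P) {d : ℕ}
    (b : Module.Basis (Fin d) ℂ P.range) {E₁ E₂ : ℂ → H →L[ℂ] H} (hE₁ : AnalyticAt ℂ E₁ z₀)
    (hE₂ : AnalyticAt ℂ E₂ z₀) (hu₁ : IsUnit (E₁ z₀)) (hu₂ : IsUnit (E₂ z₀)) (k : Fin d → ℕ)
    (h : ∀ᶠ z in 𝓝 z₀,
      A z = E₁ z * ofMatrixHom b hP (Matrix.diagonal fun i => (z - z₀) ^ k i) * E₂ z) :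
    ∃ (r : ℕ) (n : Fin r → ℕ), HasLocalSmithForm A z₀ r n ∧ ∑ j, n j = ∑ i, k i := by
  have := b.finiteDimensional_of_finite
  let e : Fin (Fintype.card {i // 1 ≤ k i}) ≃ {i // 1 ≤ k i} := (Fintype.equivFin _).symm
  let f : Fin (Fintype.card {i // 1 ≤ k i}) ≃ {i // 1 ≤ k i} :=
    (Tuple.sort fun j => k (e j)).trans e
  -- `D₀` carries the directions with exponent `0`, which belong to the complementary projection.
  let D₀ : Matrix (Fin d) (Fin d) ℂ := Matrix.diagonal fun i => if 1 ≤ k i then 0 else 1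
  have hdiag (c : Fin d → ℂ) : ofMatrix b (Matrix.diagonal c) =
      ∑ i, c i • ofMatrix b (Matrix.single i i 1) := by
    simp only [← map_smul, ← map_sum, Matrix.smul_single, smul_eq_mul, mul_one]
    congr 1
    ext i j
    simp [Matrix.diagonal_apply, Matrix.sum_apply, Matrix.single_apply, ite_and]
  refine ⟨_, fun j => k (f j), ⟨fun j => (f j).2, Tuple.monotone_sort fun j => k (e j), ?_⟩, ?_⟩
  · obtain ⟨N, hN, hNo, hz₀⟩ := _root_.eventually_nhds_iff.1 (((h.and hE₁.eventually_analyticAt).and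
      hE₂.eventually_analyticAt).and ((eventually_isUnit hE₁.continuousAt hu₁).and
        (eventually_isUnit hE₂.continuousAt hu₂)))
    refine ⟨N, E₁, E₂, ofMatrixHom b hP D₀,
      fun j => ofMatrix b (Matrix.single (f j) (f j) 1), hNo, hz₀, fun z hz => (hN z hz).1.1.2,
      fun z hz => (hN z hz).1.2, fun z hz => (hN z hz).2.1, fun z hz => (hN z hz).2.2,
      ?_, ?_, ?_, ?_, ?_, ?_, ?_⟩
    · rw [IsIdempotentElem, ← map_mul]
      congr 1
      simp only [D₀, Matrix.diagonal_mul_diagonal, mul_ite, mul_one, mul_zero]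
      congr 1
      ext i
      split_ifs <;> rfl
    · intro j
      rw [IsIdempotentElem, ← ofMatrix_mul b hP]
      simp
    · intro j
      rw [ofMatrixHom_mul_ofMatrix, ofMatrix_mul_ofMatrixHom]
      have hj := (f j).2
      constructor
      · convert map_zero (ofMatrix b)
        ext x y
        rcases eq_or_ne (f j : Fin d) x with rfl | hx
        · simp [D₀, hj]
        · simp [D₀, hx]
      · convert map_zero (ofMatrix b)
        ext x y
        rcases eq_or_ne (f j : Fin d) y with rfl | hy
        · simp [D₀, hj]
        · simp [D₀, hy]
    · intro i j hij
      rw [← ofMatrix_mul b hP, Matrix.single_mul_single_of_ne, map_zero]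
      exact fun h => hij (f.injective (Subtype.ext h))
    · have h1 : 1 - ofMatrixHom b hP D₀ = P * (P - ofMatrix b D₀) := by
        rw [ofMatrixHom_apply, mul_sub, hP.eq, mul_ofMatrix b hP]
        abel
      rw [h1]
      refine Submodule.finiteDimensional_of_le (S₂ := P.range) ?_
      rintro _ ⟨x, rfl⟩
      exact ⟨(P - ofMatrix b D₀) x, rfl⟩
    · exact fun j => finrank_range_ofMatrix_single b hP _
    · intro z hz
      rw [(hN z hz).1.1.1, sum_comp_equiv_subtype f
        fun i => (z - z₀) ^ k i • ofMatrix b (Matrix.single i i 1)]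
      congr 2
      rw [ofMatrixHom_apply, ofMatrixHom_apply, hdiag, hdiag, add_right_comm,
        ← Finset.sum_add_distrib]
      congr 1
      refine Finset.sum_congr rfl fun i _ => ?_
      split_ifs with hi
      · simp
      · have : k i = 0 := by omega
        simp [this]
  · rw [sum_comp_equiv_subtype f k]
    refine Finset.sum_congr rfl fun i _ => ?_
    split_ifs <;> omega

/-- The Smith form of the block `F` gives a local Smith form of `A`, whose exponents add up to the
order of the determinant of `F`. -/
theorem exists_hasLocalSmithForm (hA : AnalyticAt ℂ A z₀) (hfred : (A z₀).IsFredholm)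
    (hunit : ∀ᶠ z in 𝓝[≠] z₀, IsUnit (A z)) (hε : 0 < ε)
    (hiso : ∀ ζ ∈ closedBall (0 : ℂ) ε, ζ ≠ 0 → ζ ∈ resolventSet ℂ (A z₀)) :
    ∃ (r : ℕ) (n : Fin r → ℕ), HasLocalSmithForm A z₀ r n ∧
      ((∑ j, n j : ℕ) : ℕ∞) = howlandMultiplicity A z₀ ε := by
  have hs := sphere_subset_resolventSet hε hiso
  have hR := hasRieszBlockDecomposition hA hfred hε hiso
  have hP := hR.isIdempotentElem
  have := hR.finiteDimensional
  obtain ⟨E₁, E₂, hE₁, hE₂, hu₁, hu₂, hfac⟩ := exists_factorization_transformed hA hε hiso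
  set P := rieszProjection (A z₀) ε with hPdef
  let b := Module.finBasis ℂ P.range
  let M : ℂ → Matrix (Fin (Module.finrank ℂ P.range)) (Fin (Module.finrank ℂ P.range)) ℂ :=
    fun z => LinearMap.toMatrix b b (blockF A z₀ ε z).toLinearMap
  have hM : AnalyticEntriesAt M z₀ := fun i j => by
    have h1 : AnalyticAt ℂ
        (fun z => (b.coord i).toContinuousLinearMap (blockF A z₀ ε z (b j))) z₀ :=
      ((b.coord i).toContinuousLinearMap.analyticAt _).comp
        (analyticAt_clm_apply hR.analyticAt_blockF analyticAt_const)
    refine h1.congr (.of_forall fun z => ?_)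
    simp [M, LinearMap.toMatrix_apply]
  have hMu : ∀ᶠ z in 𝓝[≠] z₀, IsUnit (M z) := by
    filter_upwards [hunit, hR.isUnit_transformation.filter_mono nhdsWithin_le_nhds,
      (eventually_commute_transformed hA hε hs).filter_mono nhdsWithin_le_nhds] with z h1 h2 h3
    have hX : IsUnit (transformed A z₀ ε z) := (h2.mul h1).mul h2.ringInverse
    have hF : IsUnit (blockF A z₀ ε z) := isUnit_compress_of_commute hP hX h3
    exact isUnit_toMatrix b hF
  obtain ⟨U, V, k, hU, hV, hU0, hV0, hUV⟩ := hM.exists_smith_form _ hMu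
  have hΛ {U : ℂ → Matrix (Fin (Module.finrank ℂ P.range)) (Fin (Module.finrank ℂ P.range)) ℂ}
      (hU : AnalyticEntriesAt U z₀) : AnalyticAt ℂ (fun z => ofMatrixHom b hP (U z)) z₀ :=
    (analyticAt_ofMatrix b hU).add analyticAt_const
  obtain ⟨r, n, hn, hsum⟩ := hasLocalSmithForm_of_diagonal (A := A) (z₀ := z₀) hP b
    (E₁ := fun z => E₁ z * ofMatrixHom b hP (U z)) (E₂ := fun z => ofMatrixHom b hP (V z) * E₂ z)
    (hE₁.mul (hΛ hU)) ((hΛ hV).mul hE₂) (hu₁.mul (hU0.map _)) ((hV0.map _).mul hu₂) k (by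
      filter_upwards [hfac, hUV] with z h1 h2
      have h3 : P * transformed A z₀ ε z * P + (1 - P) = ofMatrixHom b hP (M z) := by
        rw [ofMatrixHom_apply, ← ofMatrix_toMatrix_compress b]
        rfl
      rw [h1, h3, h2, map_mul, map_mul]
      simp only [mul_assoc])
  refine ⟨r, n, hn, ?_⟩
  rw [hsum, howlandMultiplicity]
  have hdet : (fun z => LinearMap.det (blockF A z₀ ε z).toLinearMap) =ᶠ[𝓝 z₀]
      (fun z => (U z).det) * (fun z => (z - z₀) ^ ∑ i, k i) * (fun z => (V z).det) := by
    filter_upwards [hUV] with z hz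
    rw [← LinearMap.det_toMatrix b]
    change (M z).det = _
    rw [hz, Matrix.det_mul, Matrix.det_mul, Matrix.det_diagonal, Finset.prod_pow_eq_pow_sum]
    rfl
  have hpow : AnalyticAt ℂ (fun z : ℂ => (z - z₀) ^ ∑ i, k i) z₀ := by fun_prop
  have hord : analyticOrderAt (fun z : ℂ => (z - z₀) ^ ∑ i, k i) z₀ = (∑ i, k i : ℕ) :=
    analyticOrderAt_centeredMonomial
  rw [analyticOrderAt_congr hdet, analyticOrderAt_mul (hU.det.mul hpow) hV.det,
    analyticOrderAt_mul hU.det hpow, hord,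
    hU.det.analyticOrderAt_eq_zero.2 ((Matrix.isUnit_iff_isUnit_det _).1 hU0).ne_zero,
    hV.det.analyticOrderAt_eq_zero.2 ((Matrix.isUnit_iff_isUnit_det _).1 hV0).ne_zero,
    zero_add, add_zero]

end Exists

lemma HasLocalSmithForm.sum_eq_algebraicMultiplicity [CompleteSpace H]
    {A : ℂ → H →L[ℂ] H} {z₀ : ℂ} {r : ℕ} {n : Fin r → ℕ} (h : HasLocalSmithForm A z₀ r n)
    (hA : ∀ᶠ z in 𝓝[≠] z₀, IsUnit (A z)) :
    ∑ j, n j = algebraicMultiplicity A z₀ := by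
  have hex : ∃ m : ℕ, ∃ (r : ℕ) (n : Fin r → ℕ), HasLocalSmithForm A z₀ r n ∧ m = ∑ j, n j :=
    ⟨_, r, n, h, rfl⟩
  rw [algebraicMultiplicity, dif_pos hex]
  obtain ⟨r', n', h', hm⟩ := hex.choose_spec
  rw [hm, h.sum_eq_finrank hA, h'.sum_eq_finrank hA]

end Existence

end AnalyticFredholm

theorem theoremt3 {H : Type*} [NormedAddCommGroup H] [InnerProductSpace ℂ H] [CompleteSpace H]
    (Ω : Set ℂ) (hΩ : IsOpen Ω) (hΩc : IsConnected Ω)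
    (A : ℂ → H →L[ℂ] H) (hA : AnalyticOnNhd ℂ A Ω)
    (z₀ : ℂ) (hz₀ : z₀ ∈ Ω) (hzero : AnalyticFredholm.IsZeroOfFiniteType A z₀)
    -- `0` is an isolated point of the spectrum of `A z₀`, the closed disk of radius `ε` containing
    -- no other point of it, so that the Riesz projection over the circle `|ζ| = ε` is defined
    (ε : ℝ) (hε : 0 < ε)
    (hiso : ∀ ζ ∈ Metric.closedBall (0 : ℂ) ε, ζ ≠ 0 → ζ ∈ resolventSet ℂ (A z₀)) :
    -- the algebraic multiplicity is well defined
    (∃ (r : ℕ) (n : Fin r → ℕ), AnalyticFredholm.HasLocalSmithForm A z₀ r n) ∧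
    (∀ (r : ℕ) (n : Fin r → ℕ), AnalyticFredholm.HasLocalSmithForm A z₀ r n →
      ∑ j, n j = AnalyticFredholm.algebraicMultiplicity A z₀) ∧
    -- Howland's multiplicity is well defined
    AnalyticFredholm.HasRieszBlockDecomposition A z₀ ε ∧
    -- they coincide
    (AnalyticFredholm.algebraicMultiplicity A z₀ : ℕ∞) =
      AnalyticFredholm.howlandMultiplicity A z₀ ε := by
  have hAz := hA z₀ hz₀
  have hfred := hzero.isFredholm
  have hunit : ∀ᶠ z in nhdsWithin z₀ {z₀}ᶜ, IsUnit (A z) := by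
    obtain ⟨δ, hδ, h⟩ := hzero.isUnit_punctured
    filter_upwards [self_mem_nhdsWithin, mem_nhdsWithin_of_mem_nhds (Metric.ball_mem_nhds z₀ hδ)]
      with z hz hzδ
    exact h z hzδ hz
  obtain ⟨r, n, hn, hsum⟩ :=
    AnalyticFredholm.exists_hasLocalSmithForm hAz hfred hunit hε hiso
  refine ⟨⟨r, n, hn⟩, fun r n h => h.sum_eq_algebraicMultiplicity hunit,
    AnalyticFredholm.hasRieszBlockDecomposition hAz hfred hε hiso, ?_⟩
  rw [← hn.sum_eq_algebraicMultiplicity hunit, hsum]
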